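/- Consider the $(K,N,M,L)$ shared-link caching system with private demands, with integers $K\ge 1$ and $1\le L\le N$ and a real $M\in[0,N]$. A server holds $N$ independent files $F_1,\dots,F_N$ of $B$ i.i.d. uniform bits each and serves $K$ users over an error-free broadcast link. Before the demands are known, user $k$ stores $Z_k=(\mathscr M(C_k),C_k)$, where the metadata $\mathscr M(C_1),\dots,\mathscr M(C_K)$ are random variables independent of the files and of the demands, $C_k$ is a function of $(F_1,\dots,F_N,\mathscr M(C_k))$, and $H(C_k)\le MB$. Each user $k$ then demands $L$ distinct files, with indices $\mathbf d_k=(d_{k,1}<\dots<d_{k,L})$. Given the demand matrix $\mathbb D=[\mathbf d_1;\dots;\mathbf d_K]$ and the caches, the server broadcasts $X=(\mathscr M(P),P)$, where the payload $P$ is a function of $(F_1,\dots,F_N,\mathscr M(P))$. For every law of $\mathbb D$ and every $k$ it is required that $$H(\{F_i:i\in\mathbf d_k\}\mid X,Z_k,\mathbf d_k)=0\quad\text{and}\quad I(\mathbb D_{\backslash\{k\}};X,Z_k\mid \mathbf d_k)=0,$$ where $\mathbb D_{\backslash\{k\}}$ denotes the demands of the users other than $k$. The load $R$ is achievable for the memory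 size $M$ if for every $\varepsilon>0$ there are such schemes with arbitrarily large $B$ in which $H(P)\le RB$ for each demand matrix and the entropies of all the metadata are at most $\varepsilon B$. Let $R^\star$ be the infimum of the achievable loads. Let $U=\binom NL K$, and let $R_v$ be the value at $M$ of the lower convex envelope of $(0,N)$ and the points $$\Bigl(\tfrac{t}{U}N,\ L\,\tfrac{U-t}{t+1}\Bigr),\qquad t=1,\dots,U.$$ Let $R_m$ be the value at $M$ of the lower convex envelope of $(0,N)$, the points $$\Bigl(N\,\tfrac{2^{K-1}}{n_t},\ L\,\tfrac{2^K-\sum_{j=0}^{t}\binom Kj}{n_t}\Bigr),\quad n_t=2^{K-1}+\sum_{j=t}^{K-1}\binom{K-1}{j},\qquad t=0,\dots,K,$$ and the point $\bigl(\tfrac{2K-1}{2K}N,\ \tfrac{L}{2K}\bigr)$. These are the loads of the virtual-user scheme and of the MDS-based scheme. If $M\ge N/2$, then both $R_v$ and $R_m$ are order optimal within a factor of $2$: $$R^\star\le R_v\le 2R^\star\qquad\text{and}\qquad R^\star\le R_m\le 2R^\star.$$ -/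

import Mathlib

noncomputable section

namespace PrivateCaching

/-! ### Shannon entropy of finite-valued random variables (in bits)

A random variable with values in `α` is a map `X : Ω → α` on a discrete probability space, whose law
is `p : PMF Ω`. -/

/-- The Shannon entropy `H(X)`, in bits. -/
def entropy {Ω α : Type} [Fintype α] (p : PMF Ω) (X : Ω → α) : ℝ :=
  ∑ a, Real.negMulLog ((p.map X) a).toReal / Real.log 2

/-- The conditional entropy `H(X | Y) = H(X, Y) - H(Y)`. -/
def condEntropy {Ω α β : Type} [Fintype α] [Fintype β] (p : PMF Ω) (X : Ω → α) (Y : Ω → β) : ℝ :=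
  entropy p (fun ω => (X ω, Y ω)) - entropy p Y

/-- The conditional mutual information `I(X ; Y | Z) = H(X | Z) - H(X | Y, Z)`. -/
def condMutualInfo {Ω α β γ : Type} [Fintype α] [Fintype β] [Fintype γ] (p : PMF Ω)
    (X : Ω → α) (Y : Ω → β) (Z : Ω → γ) : ℝ :=
  condEntropy p X Z - condEntropy p X (fun ω => (Y ω, Z ω))

/-! ### The shared-link caching system with private demands -/

/-- The library: `N` files of `B` bits each. -/
abbrev Library (N B : ℕ) : Type := Fin N → Fin B → Bool

/-- The demand vector of one user, `d₁ < d₂ < … < d_L`, with entries among the `N` files. -/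
abbrev DemandVector (N L : ℕ) : Type := {d : Fin L → Fin N // StrictMono d}

/-- The demand matrix: one demand vector for each of the `K` users. -/
abbrev DemandMatrix (K N L : ℕ) : Type := Fin K → DemandVector N L

/-- A two-phase caching scheme for `K` users and `N` files of `B` bits, each user demanding `L` files
(no memory, decodability or privacy requirement yet). All alphabets are arbitrary finite types. -/
structure Scheme (K N L B : ℕ) where
  /-- the alphabet of the metadata of the cache of user `k` -/
  CacheMeta : Fin K → Type
  /-- the alphabet of the cached content of user `k` -/
  CacheContent : Fin K → Type
  /-- the alphabet of the metadata of the broadcast packet -/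
  PacketMeta : Type
  /-- the alphabet of the payload of the broadcast packet -/
  Payload : Type
  [fintypeCacheMeta : ∀ k, Fintype (CacheMeta k)]
  [fintypeCacheContent : ∀ k, Fintype (CacheContent k)]
  [fintypePacketMeta : Fintype PacketMeta]
  [fintypePayload : Fintype Payload]
  /-- the joint law of the metadata of the `K` caches; it depends neither on the files nor on the
  demands -/
  cacheMetaLaw : PMF (∀ k, CacheMeta k)
  /-- the cached content of user `k`, a function of the files and of the metadata of that cache -/
  cacheContent : ∀ k, Library N B → CacheMeta k → CacheContent k
  /-- the (possibly random) choice by the server of the packet metadata, given the demand matrix and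
  the caches of all the users -/
  packetMetaLaw : DemandMatrix K N L → (∀ k, CacheMeta k × CacheContent k) → PMF PacketMeta
  /-- the payload, a function of the files and of the packet metadata -/
  payload : Library N B → PacketMeta → Payload

attribute [instance] Scheme.fintypeCacheMeta Scheme.fintypeCacheContent
  Scheme.fintypePacketMeta Scheme.fintypePayload

namespace Scheme

variable {K N L B : ℕ}

/-- The elementary outcomes: demands, files, metadata of the caches, metadata of the packet. -/
structure Outcome (s : Scheme K N L B) where
  demands : DemandMatrix K N L
  files : Library N B
  cacheMeta : ∀ k, s.CacheMeta k
  packetMeta : s.PacketMeta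

/-- The cached content `C_k` of user `k`. -/
def C (s : Scheme K N L B) (k : Fin K) (o : s.Outcome) : s.CacheContent k :=
  s.cacheContent k o.files (o.cacheMeta k)

/-- The cache `Z_k` of user `k`: metadata and content. -/
def Z (s : Scheme K N L B) (k : Fin K) (o : s.Outcome) : s.CacheMeta k × s.CacheContent k :=
  (o.cacheMeta k, s.C k o)

/-- The payload `P`. -/
def P (s : Scheme K N L B) (o : s.Outcome) : s.Payload :=
  s.payload o.files o.packetMeta

/-- The broadcast packet `X`: metadata and payload. -/
def X (s : Scheme K N L B) (o : s.Outcome) : s.PacketMeta × s.Payload :=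
  (o.packetMeta, s.P o)

/-- The demand vector `d_k` of user `k`. -/
def demand (s : Scheme K N L B) (k : Fin K) (o : s.Outcome) : DemandVector N L :=
  o.demands k

/-- The demand vectors of all the users except user `k`. -/
def otherDemands (s : Scheme K N L B) (k : Fin K) (o : s.Outcome) :
    {j : Fin K // j ≠ k} → DemandVector N L :=
  fun j => o.demands j

/-- The `L` files demanded by user `k`. -/
def demandedFiles (s : Scheme K N L B) (k : Fin K) (o : s.Outcome) : Fin L → Fin B → Bool :=
  fun l => o.files ((o.demands k).1 l)

/-- The law of the system when the demand matrix is `D`: the bits of the library are independent and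
uniform, and independent of the metadata of the caches. -/
def law (s : Scheme K N L B) (D : DemandMatrix K N L) : PMF s.Outcome :=
  (PMF.uniformOfFintype (Library N B)).bind fun F =>
    s.cacheMetaLaw.bind fun m =>
      (s.packetMetaLaw D fun k => (m k, s.cacheContent k F (m k))).map fun w => ⟨D, F, m, w⟩

/-- The law of the system when the demand matrix is random with law `q`, independent of the library
and of the metadata of the caches. -/
def randomDemandLaw (s : Scheme K N L B) (q : PMF (DemandMatrix K N L)) : PMF s.Outcome :=
  q.bind s.law

/-- Decodability: `H({F_i : i ∈ d_k} | X, Z_k, d_k) = 0` for each user `k`. -/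
def Decodable (s : Scheme K N L B) : Prop :=
  ∀ (q : PMF (DemandMatrix K N L)) (k : Fin K),
    condEntropy (s.randomDemandLaw q) (s.demandedFiles k)
      (fun o => (s.X o, s.Z k o, s.demand k o)) = 0

/-- Privacy: `I(D_{∖{k}} ; X, Z_k | d_k) = 0` for each user `k`. -/
def Private (s : Scheme K N L B) : Prop :=
  ∀ (q : PMF (DemandMatrix K N L)) (k : Fin K),
    condMutualInfo (s.randomDemandLaw q) (s.otherDemands k)
      (fun o => (s.X o, s.Z k o)) (s.demand k) = 0

/-- Memory size: each cached content has entropy at most `M * B`. -/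
def MemoryAtMost (s : Scheme K N L B) (M : ℝ) : Prop :=
  ∀ (D : DemandMatrix K N L) (k : Fin K), entropy (s.law D) (s.C k) ≤ M * B

/-- Load: for each demand matrix the payload has entropy at most `R * B`. -/
def LoadAtMost (s : Scheme K N L B) (R : ℝ) : Prop :=
  ∀ D : DemandMatrix K N L, entropy (s.law D) s.P ≤ R * B

/-- The metadata of each cache and of the packet have entropy at most `ε * B`. -/
def MetadataAtMost (s : Scheme K N L B) (ε : ℝ) : Prop :=
  ∀ D : DemandMatrix K N L,
    (∀ k : Fin K, entropy (s.law D) (fun o => o.cacheMeta k) ≤ ε * B) ∧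
      entropy (s.law D) (fun o => o.packetMeta) ≤ ε * B

end Scheme

/-- The memory-load pair `(M, R)` is achievable: there are private caching schemes, for arbitrarily
large file lengths `B`, that meet the memory constraint `M`, deliver all demand matrices with load at
most `R`, and whose metadata are negligible compared to `B`. -/
def Achievable (K N L : ℕ) (M R : ℝ) : Prop :=
  ∀ ε : ℝ, 0 < ε → ∀ B₀ : ℕ, ∃ B : ℕ, B₀ ≤ B ∧ ∃ s : Scheme K N L B,
    s.Decodable ∧ s.Private ∧ s.MemoryAtMost M ∧ s.LoadAtMost R ∧ s.MetadataAtMost ε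

/-- The minimum load `R⋆` for the memory size `M`. -/
def optimalLoad (K N L : ℕ) (M : ℝ) : ℝ :=
  sInf {R : ℝ | Achievable K N L M R}

/-! ### The loads of the two schemes -/

/-- The lower convex envelope of a set of points of the plane, evaluated at the abscissa `x`. -/
def lowerConvexEnvelope (S : Set (ℝ × ℝ)) (x : ℝ) : ℝ :=
  sInf {y : ℝ | (x, y) ∈ convexHull ℝ S}

/-- The memory-load pairs of the virtual-user scheme; `U = (N choose L) * K` is the number of
effective users. -/
def virtualUserPoints (K N L : ℕ) : Set (ℝ × ℝ) :=
  let U : ℕ := N.choose L * K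
  {((0 : ℝ), (N : ℝ))} ∪
    {p | ∃ t : ℕ, 1 ≤ t ∧ t ≤ U ∧
      p = ((t : ℝ) / (U : ℝ) * (N : ℝ), (L : ℝ) * (((U : ℝ) - (t : ℝ)) / ((t : ℝ) + 1)))}

/-- The load `R_v` of the virtual-user scheme. -/
def virtualUserLoad (K N L : ℕ) (M : ℝ) : ℝ :=
  lowerConvexEnvelope (virtualUserPoints K N L) M

/-- `2^(K-1) + (K-1 choose t) + (K-1 choose t+1) + … + (K-1 choose K-1)`. -/
def mdsPieces (K t : ℕ) : ℕ :=
  2 ^ (K - 1) + ∑ j ∈ Finset.Icc t (K - 1), (K - 1).choose j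

/-- The memory-load pairs of the MDS-based scheme. -/
def mdsPoints (K N L : ℕ) : Set (ℝ × ℝ) :=
  {((0 : ℝ), (N : ℝ))} ∪
    {p | ∃ t : ℕ, t ≤ K ∧
      p = ((N : ℝ) * ((2 : ℝ) ^ (K - 1) / (mdsPieces K t : ℝ)),
        (L : ℝ) * (((2 : ℝ) ^ K - ∑ j ∈ Finset.range (t + 1), (K.choose j : ℝ)) /
          (mdsPieces K t : ℝ)))} ∪
    {((2 * (K : ℝ) - 1) / (2 * (K : ℝ)) * (N : ℝ), (L : ℝ) / (2 * (K : ℝ)))}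

/-- The load `R_m` of the MDS-based scheme. -/
def mdsLoad (K N L : ℕ) (M : ℝ) : ℝ :=
  lowerConvexEnvelope (mdsPoints K N L) M

end PrivateCaching

end

/-! Both loads are compared with the same line. The lower bound is `L * (1 - M / N) ≤ R⋆`, and on
`[N/2, N]` both envelopes lie below twice this line.

Lower bound (`Achievable.le_load`): one user suffices. Put `g S = H(F_S, Z_k)`. If the user demands
the files in `S`, then `X` and `Z_k` determine `F_S`, so `g S - g ∅ ≤ H(X)`. Since `g` is
submodular, some `S` with `L` elements gains at least the fraction `L / N` of the total increment `g
univ - g ∅`, which is at least `N B - H(Z_k)`.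

Achievability: each user keeps a uniform key in a finite abelian group `G`, independent of the other
keys, as cache metadata. The packet reveals only the pads `w k = φ (d k) - key k`. They are uniform
for every demand matrix, so user `k` sees something whose law depends on `d k` alone, and the
metadata have bounded entropy as `B` grows. It remains to find combinatorial codes (`HasCode`) that
are correct for every `w`: `HasCode.virtualUser`, with one effective user for each pair of a user
and a key, and `HasCode.mds`, `HasCode.pairs`, with one key bit for each file. Memory sharing makes
the set of limit points of codes convex (`convex_codeRegion`).

Factor 2: the line `2 * L * (1 - x / N)` vanishes at `x = N`, and `(N, 0)` belongs to both sets of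
points. So one point with abscissa at most `N / 2` on or below the line suffices
(`exists_mem_convexHull_le`), the chord to `(N, 0)` doing the rest. -/

noncomputable section

namespace PrivateCaching

/-! ### Entropy of finite laws -/

/-- The entropy, in bits, of a law on a finite type. -/
def lawEntropy {α : Type} [Fintype α] (μ : PMF α) : ℝ :=
  ∑ a, Real.negMulLog (μ a).toReal / Real.log 2

theorem entropy_eq_lawEntropy {Ω α : Type} [Fintype α] (p : PMF Ω) (X : Ω → α) :
    entropy p X = lawEntropy (p.map X) := rfl

theorem log_two_pos : 0 < Real.log 2 := Real.log_pos one_lt_two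

theorem sum_toReal_eq_one {α : Type} [Fintype α] (μ : PMF α) : ∑ a, (μ a).toReal = 1 := by
  rw [← ENNReal.toReal_sum (fun a _ => μ.apply_ne_top a), ← tsum_fintype (L := .unconditional α),
    μ.tsum_coe]
  rfl

open Classical in
theorem map_toReal {α β : Type} [Fintype α] (μ : PMF α) (f : α → β) (b : β) :
    (μ.map f b).toReal = ∑ a with f a = b, (μ a).toReal := by
  rw [PMF.map_apply, tsum_fintype, ENNReal.toReal_sum, Finset.sum_filter]
  · refine Finset.sum_congr rfl fun a _ => ?_
    by_cases h : f a = b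
    · simp [h]
    · simp [h, Ne.symm h]
  · intro a _
    split_ifs
    · exact μ.apply_ne_top a
    · simp

theorem negMulLog_sum_le {ι : Type} (s : Finset ι) (f : ι → ℝ) (hf : ∀ i ∈ s, 0 ≤ f i) :
    Real.negMulLog (∑ i ∈ s, f i) ≤ ∑ i ∈ s, Real.negMulLog (f i) := by
  have h : Real.negMulLog (∑ i ∈ s, f i) = ∑ i ∈ s, -f i * Real.log (∑ i ∈ s, f i) := by
    rw [Real.negMulLog, ← Finset.sum_mul, Finset.sum_neg_distrib]
  rw [h]
  refine Finset.sum_le_sum fun i hi => ?_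
  rcases (hf i hi).eq_or_lt with h0 | h0
  · simp [← h0]
  · have hlog : Real.log (f i) ≤ Real.log (∑ i ∈ s, f i) :=
      Real.log_le_log h0 (Finset.single_le_sum hf hi)
    rw [Real.negMulLog]
    nlinarith

theorem lawEntropy_map_le {α β : Type} [Fintype α] [Fintype β] (μ : PMF α) (f : α → β) :
    lawEntropy (μ.map f) ≤ lawEntropy μ := by
  classical
  unfold lawEntropy
  rw [← Finset.sum_div, ← Finset.sum_div]
  refine div_le_div_of_nonneg_right ?_ log_two_pos.le
  rw [← Finset.sum_fiberwise Finset.univ f]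
  refine Finset.sum_le_sum fun b _ => ?_
  rw [map_toReal]
  exact negMulLog_sum_le _ _ fun _ _ => ENNReal.toReal_nonneg

theorem map_congr_of_support {Ω α : Type} (p : PMF Ω) {X Y : Ω → α}
    (h : ∀ ω ∈ p.support, X ω = Y ω) : p.map X = p.map Y := by
  ext a
  rw [PMF.map_apply, PMF.map_apply]
  refine tsum_congr fun ω => ?_
  by_cases hω : ω ∈ p.support
  · rw [h ω hω]
  · rw [PMF.mem_support_iff, not_not] at hω
    simp [hω]

theorem entropy_congr {Ω α : Type} [Fintype α] (p : PMF Ω) {X Y : Ω → α}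
    (h : ∀ ω ∈ p.support, X ω = Y ω) : entropy p X = entropy p Y := by
  rw [entropy_eq_lawEntropy, entropy_eq_lawEntropy, map_congr_of_support p h]

/-- The entropy of a random variable that is almost surely a function of another one. -/
theorem entropy_le_of_determined {Ω α β : Type} [Fintype α] [Fintype β] (p : PMF Ω)
    (X : Ω → α) (Y : Ω → β)
    (h : ∀ ω ∈ p.support, ∀ ω' ∈ p.support, Y ω = Y ω' → X ω = X ω') :
    entropy p X ≤ entropy p Y := by
  classical
  obtain ⟨ω₀, h₀⟩ := p.support_nonempty
  let f : β → α := fun b =>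
    if hb : ∃ ω, ω ∈ p.support ∧ Y ω = b then X hb.choose else X ω₀
  have hf : ∀ ω ∈ p.support, X ω = (f ∘ Y) ω := by
    intro ω hω
    have hb : ∃ ω', ω' ∈ p.support ∧ Y ω' = Y ω := ⟨ω, hω, rfl⟩
    simp only [f, Function.comp, dif_pos hb]
    exact h _ hω _ hb.choose_spec.1 hb.choose_spec.2.symm
  rw [entropy_congr p hf, entropy_eq_lawEntropy, ← PMF.map_comp]
  exact lawEntropy_map_le _ _

theorem entropy_eq_of_determined {Ω α β : Type} [Fintype α] [Fintype β] (p : PMF Ω)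
    (X : Ω → α) (Y : Ω → β)
    (h : ∀ ω ∈ p.support, ∀ ω' ∈ p.support, Y ω = Y ω' → X ω = X ω')
    (h' : ∀ ω ∈ p.support, ∀ ω' ∈ p.support, X ω = X ω' → Y ω = Y ω') :
    entropy p X = entropy p Y :=
  le_antisymm (entropy_le_of_determined p X Y h) (entropy_le_of_determined p Y X h')

theorem condEntropy_eq_zero_of_determined {Ω α β : Type} [Fintype α] [Fintype β] (p : PMF Ω)
    (X : Ω → α) (Y : Ω → β)
    (h : ∀ ω ∈ p.support, ∀ ω' ∈ p.support, Y ω = Y ω' → X ω = X ω') :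
    condEntropy p X Y = 0 := by
  rw [condEntropy, sub_eq_zero]
  refine entropy_eq_of_determined p _ _ (fun ω hω ω' hω' hY => ?_) fun ω _ ω' _ hXY => ?_
  · exact Prod.ext (h ω hω ω' hω' hY) hY
  · exact congrArg Prod.snd hXY

/-! ### Cardinality bound, uniform laws and the chain rule -/

theorem lawEntropy_le_log_card {α : Type} [Fintype α] (μ : PMF α) :
    lawEntropy μ ≤ Real.log (Fintype.card α) / Real.log 2 := by
  unfold lawEntropy
  rw [← Finset.sum_div]
  refine div_le_div_of_nonneg_right ?_ log_two_pos.le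
  obtain ⟨a₀, -⟩ := μ.support_nonempty
  have hn : (0 : ℝ) < Fintype.card α := by exact_mod_cast Fintype.card_pos_iff.mpr ⟨a₀⟩
  -- This is `log x ≤ x - 1` at `x = 1 / (n * μ a)`, with `n` the cardinality; the correction terms
  -- sum to zero.
  have key : ∀ a, Real.negMulLog (μ a).toReal ≤
      (μ a).toReal * Real.log (Fintype.card α) + (1 / (Fintype.card α : ℝ) - (μ a).toReal) := by
    intro a
    rcases (ENNReal.toReal_nonneg (a := μ a)).eq_or_lt with h0 | h0
    · rw [← h0]
      simp
    · have h1 := Real.log_le_sub_one_of_pos (x := 1 / ((Fintype.card α : ℝ) * (μ a).toReal))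
        (by positivity)
      rw [one_div, Real.log_inv, Real.log_mul hn.ne' h0.ne'] at h1
      have h2 := mul_le_mul_of_nonneg_left h1 h0.le
      have h3 : (μ a).toReal * (((Fintype.card α : ℝ) * (μ a).toReal)⁻¹ - 1) =
          1 / (Fintype.card α : ℝ) - (μ a).toReal := by
        field_simp
      rw [Real.negMulLog]
      linarith
  refine (Finset.sum_le_sum fun a _ => key a).trans (le_of_eq ?_)
  rw [Finset.sum_add_distrib, ← Finset.sum_mul, Finset.sum_sub_distrib, sum_toReal_eq_one]
  simp [hn.ne']

theorem entropy_le_of_card_le {Ω α : Type} [Fintype α] (p : PMF Ω) (X : Ω → α) {n : ℕ}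
    (h : Fintype.card α ≤ 2 ^ n) : entropy p X ≤ n := by
  refine (lawEntropy_le_log_card _).trans ?_
  obtain ⟨ω, -⟩ := p.support_nonempty
  have hn : (0 : ℝ) < Fintype.card α := by exact_mod_cast Fintype.card_pos_iff.mpr ⟨X ω⟩
  rw [div_le_iff₀ log_two_pos, ← Real.log_pow]
  exact Real.log_le_log hn (by exact_mod_cast h)

theorem lawEntropy_uniform {α : Type} [Fintype α] [Nonempty α] :
    lawEntropy (PMF.uniformOfFintype α) = Real.log (Fintype.card α) / Real.log 2 := by
  have hn : (Fintype.card α : ℝ) ≠ 0 := by exact_mod_cast Fintype.card_ne_zero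
  simp only [lawEntropy, PMF.uniformOfFintype_apply, ENNReal.toReal_inv, ENNReal.toReal_natCast,
    Real.negMulLog, Real.log_inv, Finset.sum_const, Finset.card_univ, nsmul_eq_mul]
  field_simp

/-- The entropy of a random variable together with the output of a kernel. -/
theorem lawEntropy_bind_pair {α β : Type} [Fintype α] [Fintype β] (μ : PMF α) (κ : α → PMF β) :
    lawEntropy (μ.bind fun a => (κ a).map (Prod.mk a)) =
      lawEntropy μ + ∑ a, (μ a).toReal * lawEntropy (κ a) := by
  classical
  have hm : ∀ a b, (μ.bind (fun a => (κ a).map (Prod.mk a)) (a, b)).toReal =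
      (μ a).toReal * (κ a b).toReal := by
    intro a b
    rw [← ENNReal.toReal_mul, PMF.bind_apply, tsum_eq_single a]
    · congr 2
      rw [PMF.map_apply, tsum_eq_single b]
      · simp
      · intro b' hb'
        simp [Ne.symm hb']
    · intro a' ha'
      rw [PMF.map_apply]
      simp [Ne.symm ha']
  unfold lawEntropy
  rw [Fintype.sum_prod_type, ← Finset.sum_add_distrib]
  refine Finset.sum_congr rfl fun a _ => ?_
  simp only [hm, Real.negMulLog_mul]
  rw [← Finset.sum_div, Finset.sum_add_distrib, ← Finset.sum_mul, ← Finset.mul_sum,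
    sum_toReal_eq_one, ← Finset.sum_div]
  ring

theorem sum_mul_map {α β : Type} [Fintype α] [Fintype β] (μ : PMF α) (f : α → β) (h : β → ℝ) :
    ∑ b, (μ.map f b).toReal * h b = ∑ a, (μ a).toReal * h (f a) := by
  classical
  rw [← Finset.sum_fiberwise Finset.univ f]
  refine Finset.sum_congr rfl fun b _ => ?_
  rw [map_toReal, Finset.sum_mul]
  refine Finset.sum_congr rfl fun a ha => ?_
  rw [(Finset.mem_filter.mp ha).2]

/-! ### Submodularity of entropy -/

/-- Gibbs' inequality for `r` against `r(x,z) r(y,z) / r(z)`: by `log u ≤ u - 1` each term is at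
most the difference of the two masses, and both have the same total. When `r(z) = 0` the convention
`0 / 0 = 0` keeps the totals equal. -/
theorem sum_mul_log_ratio_nonpos {α β γ : Type} [Fintype α] [Fintype β] [Fintype γ]
    (r : α → β → γ → ℝ) (hr : ∀ x y z, 0 ≤ r x y z) :
    ∑ x, ∑ y, ∑ z, r x y z * (Real.log (∑ y', r x y' z) + Real.log (∑ x', r x' y z) -
      Real.log (∑ x', ∑ y', r x' y' z) - Real.log (r x y z)) ≤ 0 := by
  have key : ∀ x y z, r x y z * (Real.log (∑ y', r x y' z) + Real.log (∑ x', r x' y z) -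
      Real.log (∑ x', ∑ y', r x' y' z) - Real.log (r x y z)) ≤
      (∑ y', r x y' z) * (∑ x', r x' y z) / (∑ x', ∑ y', r x' y' z) - r x y z := by
    intro x y z
    have h1 : r x y z ≤ ∑ y', r x y' z :=
      Finset.single_le_sum (f := fun y' => r x y' z) (fun y' _ => hr x y' z) (Finset.mem_univ y)
    have h2 : r x y z ≤ ∑ x', r x' y z :=
      Finset.single_le_sum (f := fun x' => r x' y z) (fun x' _ => hr x' y z) (Finset.mem_univ x)
    have h3 : ∑ y', r x y' z ≤ ∑ x', ∑ y', r x' y' z :=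
      Finset.single_le_sum (f := fun x' => ∑ y', r x' y' z)
        (fun x' _ => Finset.sum_nonneg fun y' _ => hr x' y' z) (Finset.mem_univ x)
    have h0 := hr x y z
    generalize (∑ y', r x y' z) = a at *
    generalize (∑ x', r x' y z) = b at *
    generalize (∑ x', ∑ y', r x' y' z) = c at *
    generalize r x y z = s at *
    rcases h0.eq_or_lt with h | h
    · subst h
      simp only [zero_mul, sub_zero]
      exact div_nonneg (mul_nonneg h1 h2) (h1.trans h3)
    · have ha : 0 < a := h.trans_le h1
      have hb : 0 < b := h.trans_le h2
      have hc : 0 < c := ha.trans_le h3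
      have h4 := Real.log_le_sub_one_of_pos (x := a * b / (c * s)) (by positivity)
      rw [Real.log_div (by positivity) (by positivity), Real.log_mul ha.ne' hb.ne',
        Real.log_mul hc.ne' h.ne'] at h4
      have h5 := mul_le_mul_of_nonneg_left h4 h.le
      have h6 : s * (a * b / (c * s) - 1) = a * b / c - s := by
        field_simp
      linarith
  refine (Finset.sum_le_sum fun x _ => Finset.sum_le_sum fun y _ => Finset.sum_le_sum fun z _ =>
    key x y z).trans (le_of_eq ?_)
  simp only [Finset.sum_sub_distrib]
  rw [sub_eq_zero]
  have e1 : ∀ f : α → β → γ → ℝ, ∑ x, ∑ y, ∑ z, f x y z = ∑ z, ∑ x, ∑ y, f x y z := by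
    intro f
    rw [Finset.sum_comm (s := (Finset.univ : Finset γ))]
    exact Finset.sum_congr rfl fun x _ => Finset.sum_comm
  rw [e1, e1]
  refine Finset.sum_congr rfl fun z _ => ?_
  simp_rw [← Finset.sum_div, ← Finset.mul_sum, ← Finset.sum_mul]
  rw [Finset.sum_comm (f := fun y x => r x y z), mul_self_div_self]

/-- This is `I(X ; Y | Z) ≥ 0`. Each of the four entropies is an average, under the joint law, of
minus the log of a marginal, which reduces the claim to `sum_mul_log_ratio_nonpos`. -/
theorem entropy_submodular {Ω α β γ : Type} [Fintype α] [Fintype β] [Fintype γ] (p : PMF Ω)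
    (X : Ω → α) (Y : Ω → β) (Z : Ω → γ) :
    entropy p (fun ω => (X ω, Y ω, Z ω)) + entropy p Z ≤
      entropy p (fun ω => (X ω, Z ω)) + entropy p (fun ω => (Y ω, Z ω)) := by
  classical
  set μ : PMF (α × β × γ) := p.map fun ω => (X ω, Y ω, Z ω) with hμ
  let r : α → β → γ → ℝ := fun x y z => (μ (x, y, z)).toReal
  have hXYZ : entropy p (fun ω => (X ω, Y ω, Z ω)) = lawEntropy μ := rfl
  have hZ : entropy p Z = lawEntropy (μ.map fun v => v.2.2) := by
    rw [hμ, PMF.map_comp]; rfl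
  have hXZ : entropy p (fun ω => (X ω, Z ω)) = lawEntropy (μ.map fun v => (v.1, v.2.2)) := by
    rw [hμ, PMF.map_comp]; rfl
  have hYZ : entropy p (fun ω => (Y ω, Z ω)) = lawEntropy (μ.map fun v => v.2) := by
    rw [hμ, PMF.map_comp]; rfl
  have mZ : ∀ z, (μ.map (fun v => v.2.2) z).toReal = ∑ x, ∑ y, r x y z := by
    intro z
    rw [map_toReal, Finset.sum_filter, Fintype.sum_prod_type]
    refine Finset.sum_congr rfl fun x _ => ?_
    rw [Fintype.sum_prod_type]
    refine Finset.sum_congr rfl fun y _ => ?_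
    simp [r]
  have mXZ : ∀ x z, (μ.map (fun v => (v.1, v.2.2)) (x, z)).toReal = ∑ y, r x y z := by
    intro x z
    rw [map_toReal, Finset.sum_filter, Fintype.sum_prod_type, Finset.sum_eq_single x]
    · rw [Fintype.sum_prod_type]
      refine Finset.sum_congr rfl fun y _ => ?_
      simp [r]
    · intro x' _ hx'
      simp [hx']
    · simp
  have mYZ : ∀ y z, (μ.map (fun v => v.2) (y, z)).toReal = ∑ x, r x y z := by
    intro y z
    rw [map_toReal, Finset.sum_filter, Fintype.sum_prod_type]
    refine Finset.sum_congr rfl fun x _ => ?_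
    rw [Finset.sum_eq_single (y, z)]
    · simp [r]
    · intro v _ hv
      simp [hv]
    · simp
  have expand : ∀ {δ : Type} [Fintype δ] (f : α × β × γ → δ), lawEntropy (μ.map f) =
      (∑ x, ∑ y, ∑ z, r x y z * -Real.log (μ.map f (f (x, y, z))).toReal) / Real.log 2 := by
    intro δ _ f
    have h := sum_mul_map μ f fun d => -Real.log (μ.map f d).toReal
    simp only [Fintype.sum_prod_type] at h
    rw [← h, lawEntropy, Finset.sum_div]
    refine Finset.sum_congr rfl fun d _ => ?_
    rw [Real.negMulLog]
    ring
  have h := sum_mul_log_ratio_nonpos r fun x y z => ENNReal.toReal_nonneg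
  have hμ' : lawEntropy μ = lawEntropy (μ.map id) := by rw [PMF.map_id]
  rw [hXYZ, hZ, hXZ, hYZ, hμ', expand, expand, expand, expand, ← add_div, ← add_div]
  refine div_le_div_of_nonneg_right ?_ log_two_pos.le
  simp only [mZ, mXZ, mYZ, PMF.map_id, id]
  rw [← sub_nonpos]
  refine le_of_eq_of_le ?_ (h)
  simp only [← Finset.sum_add_distrib, ← Finset.sum_sub_distrib]
  refine Finset.sum_congr rfl fun x _ => Finset.sum_congr rfl fun y _ =>
    Finset.sum_congr rfl fun z _ => ?_
  simp only [r]
  ring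

theorem entropy_const {Ω α : Type} [Fintype α] (p : PMF Ω) (a : α) :
    entropy p (fun _ => a) = 0 := by
  classical
  refine Finset.sum_eq_zero fun b _ => ?_
  rw [show p.map (fun _ => a) = PMF.pure a from PMF.map_const p a, PMF.pure_apply]
  split_ifs <;> simp

theorem entropy_pair_le {Ω α β : Type} [Fintype α] [Fintype β] (p : PMF Ω)
    (X : Ω → α) (Y : Ω → β) :
    entropy p (fun ω => (X ω, Y ω)) ≤ entropy p X + entropy p Y := by
  have h := entropy_submodular p X Y fun _ => ()
  rw [entropy_const, add_zero] at h
  refine ((entropy_le_of_determined p _ _ ?_).trans h).trans (add_le_add ?_ ?_)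
  · intro ω _ ω' _ h
    simp only [Prod.mk.injEq] at h ⊢
    exact ⟨h.1, h.2.1⟩
  · exact entropy_le_of_determined p _ _ fun ω _ ω' _ h => by simp [h]
  · exact entropy_le_of_determined p _ _ fun ω _ ω' _ h => by simp [h]

/-! ### The converse bound -/

/-- Average over the `N` cyclic windows of length `L`: each index lies in exactly `L` of them, so
some window is at least as heavy as the mean. -/
theorem exists_card_eq_mul_sum_le {N L : ℕ} (hLN : L ≤ N) (h : Fin N → ℝ) :
    ∃ S : Finset (Fin N), S.card = L ∧ (L : ℝ) * ∑ i, h i ≤ N * ∑ i ∈ S, h i := by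
  rcases Nat.eq_zero_or_pos N with rfl | hN
  · exact ⟨∅, by simp; omega, by simp⟩
  have : NeZero N := ⟨hN.ne'⟩
  let c : Fin N → Fin L → Fin N := fun j l => j + Fin.castLE hLN l
  have hc : ∀ j, Function.Injective (c j) := fun j l l' hl =>
    Fin.castLE_injective hLN (add_left_cancel hl)
  have htot : ∑ j, ∑ l, h (c j l) = ∑ _j : Fin N, (L : ℝ) * (∑ i, h i) / N := by
    rw [Finset.sum_comm]
    have : ∀ l : Fin L, ∑ j, h (c j l) = ∑ i, h i := fun l =>
      Equiv.sum_comp (Equiv.addRight (Fin.castLE hLN l)) h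
    simp only [this]
    have hN' : (N : ℝ) ≠ 0 := by exact_mod_cast hN.ne'
    simp
    field_simp
  obtain ⟨j, -, hj⟩ := Finset.exists_le_of_sum_le Finset.univ_nonempty htot.ge
  refine ⟨Finset.univ.image (c j), ?_, ?_⟩
  · rw [Finset.card_image_of_injective _ (hc j), Finset.card_univ, Fintype.card_fin]
  · rw [Finset.sum_image fun l _ l' _ hl => hc j hl]
    have hN' : (0 : ℝ) < N := by exact_mod_cast hN
    rw [div_le_iff₀ hN'] at hj
    linarith

/-- Let `h i` be the increment of `g` when `i` joins the indices below it. Increments shrink as the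
base set grows, so `∑ i ∈ S, h i ≤ g S - g ∅`, with equality for initial segments, in particular for
`univ`. The heavy window for `h` is the required set. -/
theorem exists_card_eq_of_submodular {N L : ℕ} (hLN : L ≤ N) (g : Finset (Fin N) → ℝ)
    (hg : ∀ S T i, S ⊆ T → g (insert i T) + g S ≤ g (insert i S) + g T) :
    ∃ S : Finset (Fin N), S.card = L ∧
      (L : ℝ) * (g Finset.univ - g ∅) ≤ N * (g S - g ∅) := by
  let h : Fin N → ℝ := fun i => g (insert i (Finset.Iio i)) - g (Finset.Iio i)
  have hle : ∀ S, ∑ i ∈ S, h i ≤ g S - g ∅ := by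
    intro S
    induction S using Finset.induction_on_max with
    | empty => simp
    | insert a s ha ih =>
      rw [Finset.sum_insert fun h' => (ha a h').false]
      have := hg s (Finset.Iio a) a fun x hx => Finset.mem_Iio.mpr (ha x hx)
      simp only [h] at ih ⊢
      linarith
  have heq : ∀ S : Finset (Fin N), IsLowerSet (S : Set (Fin N)) →
      g S - g ∅ = ∑ i ∈ S, h i := by
    intro S
    induction S using Finset.induction_on_max with
    | empty => simp
    | insert a s ha ih =>
      intro hs
      have hsa : s = Finset.Iio a := by
        ext x
        refine ⟨fun hx => Finset.mem_Iio.mpr (ha x hx), fun hx => ?_⟩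
        rw [Finset.mem_Iio] at hx
        have := hs hx.le (Finset.mem_coe.mpr (Finset.mem_insert_self a s))
        exact Finset.mem_of_mem_insert_of_ne (Finset.mem_coe.mp this) hx.ne
      rw [Finset.sum_insert fun h' => (ha a h').false, ← ih]
      · simp only [h, ← hsa]
        ring
      · rw [hsa, Finset.coe_Iio]
        exact isLowerSet_Iio a
  obtain ⟨S, hS, hS'⟩ := exists_card_eq_mul_sum_le hLN h
  refine ⟨S, hS, ?_⟩
  rw [heq Finset.univ (by rw [Finset.coe_univ]; exact isLowerSet_univ)]
  exact hS'.trans (mul_le_mul_of_nonneg_left (hle S) (Nat.cast_nonneg N))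

/-- The files with indices in `S`, the other ones being erased. -/
def maskLibrary {N B : ℕ} (S : Finset (Fin N)) (F : Library N B) : Library N B :=
  fun i => if i ∈ S then F i else fun _ => false

theorem maskLibrary_eq_iff {N B : ℕ} {S : Finset (Fin N)} {F F' : Library N B} :
    maskLibrary S F = maskLibrary S F' ↔ ∀ i ∈ S, F i = F' i := by
  rw [funext_iff]
  refine forall_congr' fun i => ?_
  by_cases hi : i ∈ S <;> simp [maskLibrary, hi]

/-! ### The cut-set bound for one user -/

namespace Scheme

variable {K N L B : ℕ}

/-- The joint law of the library and of the metadata of the caches. -/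
def placementLaw (s : Scheme K N L B) : PMF (Library N B × ∀ k, s.CacheMeta k) :=
  (PMF.uniformOfFintype (Library N B)).bind fun F => s.cacheMetaLaw.map (Prod.mk F)

theorem map_law_placement (s : Scheme K N L B) (D : DemandMatrix K N L) :
    (s.law D).map (fun o => (o.files, o.cacheMeta)) = s.placementLaw := by
  rw [law, placementLaw, PMF.map_bind]
  congr 1
  funext F
  rw [PMF.map_bind, ← PMF.bind_pure_comp]
  congr 1
  funext m
  rw [PMF.map_comp]
  exact PMF.map_const _ (F, m)

/-- The demand enters the law only through the packet metadata. Hence entropies of files and caches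
can be fixed before the demand is chosen, and the converse may pick the worst demand afterwards. -/
theorem entropy_law_placement (s : Scheme K N L B) (D : DemandMatrix K N L) {α : Type}
    [Fintype α] (f : Library N B × (∀ k, s.CacheMeta k) → α) :
    entropy (s.law D) (fun o => f (o.files, o.cacheMeta)) = entropy s.placementLaw f := by
  rw [entropy_eq_lawEntropy, entropy_eq_lawEntropy, ← s.map_law_placement D, PMF.map_comp]
  rfl

theorem entropy_placementLaw_files (s : Scheme K N L B) :
    entropy s.placementLaw Prod.fst = N * B := by
  have h : s.placementLaw.map Prod.fst = PMF.uniformOfFintype (Library N B) := by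
    rw [placementLaw, PMF.map_bind]
    conv_rhs => rw [← PMF.bind_pure (PMF.uniformOfFintype (Library N B))]
    congr 1
    funext F
    rw [PMF.map_comp]
    exact PMF.map_const _ _
  rw [entropy_eq_lawEntropy, h, lawEntropy_uniform]
  have h2 : Real.log 2 ≠ 0 := log_two_pos.ne'
  simp
  field_simp

theorem demands_eq_of_mem_support (s : Scheme K N L B) (D : DemandMatrix K N L) {o : s.Outcome}
    (ho : o ∈ (s.law D).support) : o.demands = D := by
  simp only [law, PMF.mem_support_bind_iff, PMF.mem_support_map_iff] at ho
  obtain ⟨F, -, m, -, w, -, rfl⟩ := ho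
  rfl

/-- The cache of user `k` as a function of the library and of the metadata. -/
def placedCache (s : Scheme K N L B) (k : Fin K)
    (v : Library N B × ∀ k, s.CacheMeta k) : s.CacheMeta k × s.CacheContent k :=
  (v.2 k, s.cacheContent k v.1 (v.2 k))

theorem entropy_mask_cache_le (s : Scheme K N L B) (hs : s.Decodable) (k : Fin K)
    (d : DemandVector N L) :
    entropy s.placementLaw (fun v => (maskLibrary (Finset.univ.image d.1) v.1, s.placedCache k v)) ≤
      entropy (s.law fun _ => d) (fun o => o.packetMeta) + entropy (s.law fun _ => d) s.P +
        entropy s.placementLaw (s.placedCache k) := by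
  set D : DemandMatrix K N L := fun _ => d with hD
  -- For a point mass, decodability says that adjoining the demanded files to `(X, Z_k, d_k)` does
  -- not change the entropy.
  have hdec := hs (PMF.pure D) k
  rw [randomDemandLaw, PMF.pure_bind, condEntropy, sub_eq_zero] at hdec
  rw [← s.entropy_law_placement D, ← s.entropy_law_placement D]
  have hdem : ∀ o ∈ (s.law D).support, o.demands k = d := fun o ho => by
    rw [s.demands_eq_of_mem_support D ho]
  calc _ ≤ entropy (s.law D) (fun o => (s.demandedFiles k o, s.X o, s.Z k o, s.demand k o)) := by
        refine entropy_le_of_determined _ _ _ fun o ho o' ho' h => ?_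
        simp only [Prod.mk.injEq] at h ⊢
        refine ⟨maskLibrary_eq_iff.mpr fun i hi => ?_, h.2.2.1⟩
        obtain ⟨l, -, rfl⟩ := Finset.mem_image.mp hi
        have := congrFun h.1 l
        simpa only [demandedFiles, hdem o ho, hdem o' ho'] using this
    _ = entropy (s.law D) (fun o => (s.X o, s.Z k o, s.demand k o)) := hdec
    _ ≤ entropy (s.law D) (fun o => (s.X o, s.Z k o)) := by
        refine entropy_le_of_determined _ _ _ fun o ho o' ho' h => ?_
        simp only [Prod.mk.injEq] at h ⊢
        exact ⟨h.1, h.2, (hdem o ho).trans (hdem o' ho').symm⟩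
    _ ≤ entropy (s.law D) s.X + entropy (s.law D) (s.Z k) := entropy_pair_le _ _ _
    _ ≤ _ := add_le_add (entropy_pair_le _ _ _) le_rfl

theorem converse (s : Scheme K N L B) (hs : s.Decodable) (k : Fin K) (hLN : L ≤ N)
    {M R ε : ℝ} (hM : s.MemoryAtMost M) (hR : s.LoadAtMost R) (hε : s.MetadataAtMost ε) :
    (L : ℝ) * (N * B - (M + ε) * B) ≤ N * ((R + ε) * B) := by
  -- Masking, rather than restricting to `S`, keeps one alphabet for all `S`.
  let g : Finset (Fin N) → ℝ := fun S =>
    entropy s.placementLaw (fun v => (maskLibrary S v.1, s.placedCache k v))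
  have hg : ∀ S T i, S ⊆ T → g (insert i T) + g S ≤ g (insert i S) + g T := by
    intro S T i hST
    have h := entropy_submodular s.placementLaw (fun v => v.1 i) (fun v => maskLibrary T v.1)
      fun v => (maskLibrary S v.1, s.placedCache k v)
    refine (add_le_add ?_ le_rfl).trans (h.trans (add_le_add ?_ ?_))
    · refine entropy_le_of_determined _ _ _ fun v _ v' _ h => ?_
      simp only [Prod.mk.injEq, maskLibrary_eq_iff, Finset.forall_mem_insert] at h ⊢
      exact ⟨⟨h.1, h.2.1⟩, h.2.2.2⟩
    · refine entropy_le_of_determined _ _ _ fun v _ v' _ h => ?_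
      simp only [Prod.mk.injEq, maskLibrary_eq_iff, Finset.forall_mem_insert] at h ⊢
      exact ⟨h.1.1, h.1.2, h.2⟩
    · refine entropy_le_of_determined _ _ _ fun v _ v' _ h => ?_
      simp only [Prod.mk.injEq, maskLibrary_eq_iff] at h ⊢
      exact ⟨h.1, fun j hj => h.1 j (hST hj), h.2⟩
  obtain ⟨S, hS, hineq⟩ := exists_card_eq_of_submodular hLN g hg
  let d : DemandVector N L := ⟨S.orderEmbOfFin hS, (S.orderEmbOfFin hS).strictMono⟩
  have hd : Finset.univ.image d.1 = S := by
    ext i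
    simp [d]
  have h0 : g ∅ = entropy s.placementLaw (s.placedCache k) := by
    refine entropy_eq_of_determined _ _ _ (fun v _ v' _ h => ?_) fun v _ v' _ h => ?_
    · rw [Prod.mk.injEq, maskLibrary_eq_iff]
      exact ⟨by simp, h⟩
    · exact congrArg Prod.snd h
  have h1 : (N : ℝ) * B ≤ g Finset.univ := by
    rw [← s.entropy_placementLaw_files]
    refine entropy_le_of_determined _ _ _ fun v _ v' _ h => ?_
    simp only [Prod.mk.injEq, maskLibrary_eq_iff] at h
    exact funext fun i => h.1 i (Finset.mem_univ i)
  have h2 : entropy s.placementLaw (s.placedCache k) ≤ (M + ε) * B := by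
    rw [← s.entropy_law_placement fun _ => d]
    refine (entropy_pair_le _ _ _).trans ?_
    have hC : entropy (s.law fun _ => d) (fun o => s.cacheContent k o.files (o.cacheMeta k)) ≤
      M * B := hM (fun _ => d) k
    have := (hε (fun _ => d)).1 k
    linarith
  have h3 := s.entropy_mask_cache_le hs k d
  rw [hd] at h3
  have h4 : g S - g ∅ ≤ (R + ε) * B := by
    have := hR fun _ => d
    have := (hε fun _ => d).2
    rw [h0]
    simp only [g]
    linarith
  calc (L : ℝ) * (N * B - (M + ε) * B) ≤ L * (g Finset.univ - g ∅) :=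
        mul_le_mul_of_nonneg_left (by linarith) (Nat.cast_nonneg L)
    _ ≤ N * (g S - g ∅) := hineq
    _ ≤ _ := mul_le_mul_of_nonneg_left h4 (Nat.cast_nonneg N)

end Scheme

theorem Achievable.le_load {K N L : ℕ} {M R : ℝ} (h : Achievable K N L M R) (hK : 1 ≤ K)
    (hL : 1 ≤ L) (hLN : L ≤ N) : (L : ℝ) * (1 - M / N) ≤ R := by
  have hN : (0 : ℝ) < N := by exact_mod_cast hL.trans hLN
  have key : ∀ ε : ℝ, 0 < ε → (L : ℝ) * (N - M) ≤ N * R + ε := by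
    intro ε hε
    -- The metadata cost `L + N` times their bound, which is chosen so that the total is `ε`; the
    -- lower bound `1` on `B` allows division by `B`.
    obtain ⟨B, hB, s, hdec, -, hM, hR, hmeta⟩ := h (ε / (L + N)) (by positivity) 1
    have hB' : (0 : ℝ) < B := by exact_mod_cast hB
    have := s.converse hdec ⟨0, hK⟩ hLN hM hR hmeta
    have h1 : ((L : ℝ) * (N - M - ε / (L + N))) * B ≤ (N * (R + ε / (L + N))) * B := by
      linarith
    have h2 := le_of_mul_le_mul_right h1 hB'
    have h3 : (L + N) * (ε / (L + N)) = ε := by field_simp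
    linarith
  have h1 := le_of_forall_pos_le_add key
  have h2 : (L : ℝ) * (1 - M / N) = L * (N - M) / N := by field_simp
  rw [h2, div_le_iff₀ hN]
  linarith

/-! ### Schemes whose demands are hidden by a one-time pad -/

theorem map_equiv_uniformOfFintype {α : Type} [Fintype α] [Nonempty α] (e : α ≃ α) :
    (PMF.uniformOfFintype α).map e = PMF.uniformOfFintype α := by
  ext a
  rw [PMF.map_apply, tsum_eq_single (e.symm a)]
  · simp
  · intro b hb
    rw [if_neg]
    rintro rfl
    exact hb (e.symm_apply_apply b).symm

/-- If the packet and the cache of user `k` depend on the demand matrix through the demand of user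
`k` only, then they reveal nothing about the demands of the other users. -/
theorem Scheme.condMutualInfo_eq_zero {K N L B : ℕ} (s : Scheme K N L B) (k : Fin K)
    (ρ : DemandVector N L →
      PMF ((s.PacketMeta × s.Payload) × (s.CacheMeta k × s.CacheContent k)))
    (hρ : ∀ D, (s.law D).map (fun o => (s.X o, s.Z k o)) = ρ (D k))
    (q : PMF (DemandMatrix K N L)) :
    condMutualInfo (s.randomDemandLaw q) (s.otherDemands k)
      (fun o => (s.X o, s.Z k o)) (s.demand k) = 0 := by
  classical
  set p := s.randomDemandLaw q with hp
  have hlaw : ∀ D, (s.law D).map (fun o => (o.demands, (s.X o, s.Z k o))) =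
      (ρ (D k)).map (Prod.mk D) := by
    intro D
    rw [← hρ D, PMF.map_comp]
    refine map_congr_of_support _ fun o ho => ?_
    rw [s.demands_eq_of_mem_support D ho]
    rfl
  have hDY : p.map (fun o => (o.demands, (s.X o, s.Z k o))) =
      q.bind fun D => (ρ (D k)).map (Prod.mk D) := by
    rw [hp, Scheme.randomDemandLaw, PMF.map_bind]
    simp only [hlaw]
  have hD : p.map (fun o => o.demands) = q := by
    have := congrArg (PMF.map Prod.fst) hDY
    rw [PMF.map_comp, PMF.map_bind] at this
    refine this.trans ?_
    conv_rhs => rw [← PMF.bind_pure q]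
    congr 1
    funext D
    rw [PMF.map_comp]
    exact PMF.map_const _ D
  have hdY : p.map (fun o => (s.demand k o, (s.X o, s.Z k o))) =
      (q.map fun D => D k).bind fun d => (ρ d).map (Prod.mk d) := by
    have := congrArg (PMF.map fun v : DemandMatrix K N L × _ => (v.1 k, v.2)) hDY
    rw [PMF.map_comp, PMF.map_bind] at this
    refine this.trans ?_
    rw [PMF.bind_map]
    congr 1
    funext D
    rw [PMF.map_comp]
    rfl
  have hd : p.map (s.demand k) = q.map fun D => D k := by
    rw [← hD, PMF.map_comp]
    rfl
  have split : ∀ {o o' : s.Outcome}, s.otherDemands k o = s.otherDemands k o' →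
      s.demand k o = s.demand k o' → o.demands = o'.demands := by
    intro o o' h1 h2
    funext j
    by_cases hj : j = k
    · rw [hj]
      exact h2
    · exact congrFun h1 ⟨j, hj⟩
  have other : ∀ {o o' : s.Outcome}, o.demands = o'.demands →
      s.otherDemands k o = s.otherDemands k o' ∧ s.demand k o = s.demand k o' := by
    intro o o' h
    exact ⟨funext fun j => congrFun h j, congrFun h k⟩
  -- By the chain rule, revealing `(X, Z_k)` adds the same mean `∑ D, q D * H(ρ (D k))` to the
  -- entropy of all the demands and to that of `d_k`, so the two contributions cancel.
  have e1 : entropy p (fun o => (s.otherDemands k o, s.demand k o)) = lawEntropy q := by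
    rw [← hD, ← entropy_eq_lawEntropy]
    refine entropy_eq_of_determined _ _ _ (fun o _ o' _ h => ?_) fun o _ o' _ h => ?_
    · exact Prod.ext (other h).1 (other h).2
    · exact split (congrArg Prod.fst h) (congrArg Prod.snd h)
  have e2 : entropy p (fun o => (s.otherDemands k o, ((s.X o, s.Z k o), s.demand k o))) =
      lawEntropy q + ∑ D, (q D).toReal * lawEntropy (ρ (D k)) := by
    rw [← lawEntropy_bind_pair, ← hDY, ← entropy_eq_lawEntropy]
    refine entropy_eq_of_determined _ _ _ (fun o _ o' _ h => ?_) fun o _ o' _ h => ?_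
    · rw [Prod.mk.injEq] at h
      rw [Prod.mk.injEq, Prod.mk.injEq]
      exact ⟨(other h.1).1, h.2, (other h.1).2⟩
    · rw [Prod.mk.injEq, Prod.mk.injEq] at h
      exact Prod.ext (split h.1 h.2.2) h.2.1
  have e3 : entropy p (fun o => ((s.X o, s.Z k o), s.demand k o)) =
      lawEntropy (q.map fun D => D k) + ∑ D, (q D).toReal * lawEntropy (ρ (D k)) := by
    rw [← sum_mul_map q (fun D => D k) fun d => lawEntropy (ρ d), ← lawEntropy_bind_pair, ← hdY,
      ← entropy_eq_lawEntropy]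
    refine entropy_eq_of_determined _ _ _ (fun o _ o' _ h => ?_) fun o _ o' _ h => ?_ <;>
    · rw [Prod.mk.injEq] at h ⊢
      exact ⟨h.2, h.1⟩
  have e4 : entropy p (s.demand k) = lawEntropy (q.map fun D => D k) := by
    rw [entropy_eq_lawEntropy, hd]
  rw [condMutualInfo, condEntropy, condEntropy, e1, e2, e3, e4]
  ring

section PadScheme

variable {K N L B c p : ℕ} {G : Type} [AddCommGroup G] [Fintype G]

/-- The scheme in which the demand of user `k`, encoded by `φ`, is hidden by a uniform key that is
the metadata of the cache of user `k`. -/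
def padScheme (φ : DemandVector N L → G)
    (cache : Fin K → G → Library N B → Fin (2 ^ c))
    (payload : (Fin K → G) → Library N B → Fin (2 ^ p)) : Scheme K N L B where
  CacheMeta := fun _ => G
  CacheContent := fun _ => Fin (2 ^ c)
  PacketMeta := Fin K → G
  Payload := Fin (2 ^ p)
  fintypePacketMeta := Fintype.ofFinite _
  cacheMetaLaw := haveI := Fintype.ofFinite (Fin K → G); PMF.uniformOfFintype (Fin K → G)
  cacheContent := fun k F g => cache k g F
  packetMetaLaw := fun D z => PMF.pure fun k => φ (D k) - (z k).1
  payload := fun F w => payload w F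

variable (φ : DemandVector N L → G) (cache : Fin K → G → Library N B → Fin (2 ^ c))
  (payload : (Fin K → G) → Library N B → Fin (2 ^ p))

/-- The key is recovered from the pad and the demand, so the cache of user `k` becomes a function of
`w`, `d k` and the files, the form in which codes are stated. -/
theorem padScheme_key_eq (q : PMF (DemandMatrix K N L)) {o : (padScheme φ cache payload).Outcome}
    (ho : o ∈ ((padScheme φ cache payload).randomDemandLaw q).support) (k : Fin K) :
    o.cacheMeta k = φ (o.demands k) - o.packetMeta k := by
  obtain ⟨D, -, ho⟩ := (PMF.mem_support_bind_iff _ _ _).mp ho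
  obtain ⟨F, -, ho⟩ := (PMF.mem_support_bind_iff _ _ _).mp ho
  obtain ⟨m, -, ho⟩ := (PMF.mem_support_bind_iff _ _ _).mp ho
  obtain ⟨w, hw, rfl⟩ := (PMF.mem_support_map_iff _ _ _).mp ho
  obtain rfl := (PMF.mem_support_pure_iff _ _).mp hw
  exact (sub_sub_cancel (φ (D k)) (m k : G)).symm

theorem padScheme_decodable
    (hdec : ∀ w k d F F', cache k (φ d - w k) F = cache k (φ d - w k) F' →
      payload w F = payload w F' → ∀ l, F (d.1 l) = F' (d.1 l)) :
    (padScheme φ cache payload).Decodable := by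
  intro q k
  refine condEntropy_eq_zero_of_determined _ _ _ fun o ho o' ho' h => ?_
  have hk := padScheme_key_eq φ cache payload q ho k
  have hk' := padScheme_key_eq φ cache payload q ho' k
  simp only [Prod.mk.injEq, Scheme.X, Scheme.Z, Scheme.demand, Scheme.P, Scheme.C] at h
  obtain ⟨⟨hw, hP⟩, ⟨-, hC⟩, hd⟩ := h
  change cache k (o.cacheMeta k) o.files = cache k (o'.cacheMeta k) o'.files at hC
  change payload o.packetMeta o.files = payload o'.packetMeta o'.files at hP
  rw [hk, hk', ← hw, ← hd] at hC
  rw [← hw] at hP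
  funext l
  simp only [Scheme.demandedFiles, ← hd]
  exact hdec _ _ _ _ _ hC hP l

/-- For a fixed library, the change of variables `m ↦ φ ∘ D - m` preserves the uniform law of the
keys. In the new variable `w` the view of user `k` involves `D` only through `D k`. -/
theorem padScheme_private : (padScheme φ cache payload).Private := by
  intro q k
  let s := padScheme φ cache payload
  let U : PMF (Fin K → G) := haveI := Fintype.ofFinite (Fin K → G); PMF.uniformOfFintype _
  let view : DemandVector N L → Library N B → (Fin K → G) →
      ((Fin K → G) × Fin (2 ^ p)) × (G × Fin (2 ^ c)) := fun d F w =>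
    ((w, payload w F), (φ d - w k, cache k (φ d - w k) F))
  refine s.condMutualInfo_eq_zero k (fun d =>
    (PMF.uniformOfFintype (Library N B)).bind fun F => U.map (view d F)) (fun D => ?_) q
  rw [Scheme.law, PMF.map_bind]
  congr 1
  funext F
  have hU : U.map (fun m j => φ (D j) - m j) = U :=
    letI := Fintype.ofFinite (Fin K → G)
    map_equiv_uniformOfFintype (Equiv.subLeft fun j => φ (D j))
  have hview : U.map (view (D k) F) = U.map (view (D k) F ∘ fun m j => φ (D j) - m j) := by
    rw [← PMF.map_comp, hU]
  refine Eq.trans ?_ hview.symm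
  rw [PMF.map_bind, ← PMF.bind_pure_comp]
  change U.bind _ = _
  congr 1
  refine funext fun (m : Fin K → G) => ?_
  change PMF.map _ (PMF.map _ (PMF.pure _)) = _
  refine (congrArg (PMF.map _) (PMF.pure_map _ _)).trans ((PMF.pure_map _ _).trans ?_)
  have hm : φ (D k) - (φ (D k) - m k) = m k := sub_sub_cancel _ _
  change _ = PMF.pure (view (D k) F fun j => φ (D j) - m j)
  simp only [view, hm]
  rfl

end PadScheme

/-- Placement and delivery functions for files of `b` bits, contents of `c` bits and payloads of
`p` bits, that let a user with demand `d` and key `φ d - w k` decode from a payload with pads `w`. -/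
def HasCode (K : ℕ) {N L : ℕ} {G : Type} [AddCommGroup G] (φ : DemandVector N L → G)
    (b c p : ℕ) : Prop :=
  ∃ (A : Type) (C : Fin K → G → Type) (P : (Fin K → G) → Type)
    (_ : Fintype A) (_ : ∀ k g, Fintype (C k g)) (_ : ∀ w, Fintype (P w))
    (cache : ∀ k g, (Fin N → A) → C k g) (payload : ∀ w, (Fin N → A) → P w),
    Fintype.card A = 2 ^ b ∧ (∀ k g, Fintype.card (C k g) ≤ 2 ^ c) ∧
    (∀ w, Fintype.card (P w) ≤ 2 ^ p) ∧
    ∀ (w : Fin K → G) (k : Fin K) (d : DemandVector N L) (F F' : Fin N → A),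
      cache k (φ d - w k) F = cache k (φ d - w k) F' → payload w F = payload w F' →
        ∀ l, F (d.1 l) = F' (d.1 l)

theorem HasCode.exists_bits {K N L : ℕ} {G : Type} [AddCommGroup G] {φ : DemandVector N L → G}
    {b c p : ℕ} (h : HasCode K φ b c p) :
    ∃ (cache : Fin K → G → Library N b → Fin (2 ^ c))
      (payload : (Fin K → G) → Library N b → Fin (2 ^ p)),
      ∀ w k d F F', cache k (φ d - w k) F = cache k (φ d - w k) F' →
        payload w F = payload w F' → ∀ l, F (d.1 l) = F' (d.1 l) := by
  obtain ⟨A, C, P, _, _, _, cache, payload, hA, hC, hP, hdec⟩ := h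
  have e : (Fin b → Bool) ≃ A := Fintype.equivOfCardEq (by simp [hA])
  have iC : ∀ k g, Nonempty (C k g ↪ Fin (2 ^ c)) := fun k g =>
    Function.Embedding.nonempty_of_card_le (by simpa using hC k g)
  have iP : ∀ w, Nonempty (P w ↪ Fin (2 ^ p)) := fun w =>
    Function.Embedding.nonempty_of_card_le (by simpa using hP w)
  refine ⟨fun k g F => (iC k g).some (cache k g fun i => e (F i)),
    fun w F => (iP w).some (payload w fun i => e (F i)), fun w k d F F' h1 h2 l => ?_⟩
  exact e.injective (hdec w k d _ _ ((iC _ _).some.injective h1) ((iP _).some.injective h2) l)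

/-- Files are cut into two pieces coded separately. The same pads serve both, so splitting costs no
extra metadata. -/
theorem HasCode.add {K N L : ℕ} {G : Type} [AddCommGroup G] {φ : DemandVector N L → G}
    {b c p b' c' p' : ℕ} (h : HasCode K φ b c p) (h' : HasCode K φ b' c' p') :
    HasCode K φ (b + b') (c + c') (p + p') := by
  obtain ⟨A, C, P, _, _, _, cache, payload, hA, hC, hP, hdec⟩ := h
  obtain ⟨A', C', P', _, _, _, cache', payload', hA', hC', hP', hdec'⟩ := h'
  refine ⟨A × A', fun k g => C k g × C' k g, fun w => P w × P' w, inferInstance,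
    fun _ _ => inferInstance, fun _ => inferInstance,
    fun k g F => (cache k g fun i => (F i).1, cache' k g fun i => (F i).2),
    fun w F => (payload w fun i => (F i).1, payload' w fun i => (F i).2), ?_, ?_, ?_, ?_⟩
  · rw [Fintype.card_prod, hA, hA', pow_add]
  · intro k g
    rw [Fintype.card_prod, pow_add]
    exact Nat.mul_le_mul (hC k g) (hC' k g)
  · intro w
    rw [Fintype.card_prod, pow_add]
    exact Nat.mul_le_mul (hP w) (hP' w)
  · intro w k d F F' h1 h2 l
    rw [Prod.mk.injEq] at h1 h2
    exact Prod.ext (hdec w k d _ _ h1.1 h2.1 l) (hdec' w k d _ _ h1.2 h2.2 l)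

theorem HasCode.zero {K N L : ℕ} {G : Type} [AddCommGroup G] (φ : DemandVector N L → G) :
    HasCode K φ 0 0 0 :=
  ⟨Unit, fun _ _ => Unit, fun _ => Unit, inferInstance, fun _ _ => inferInstance,
    fun _ => inferInstance, fun _ _ _ => (), fun _ _ => (), by simp, by simp, by simp,
    fun _ _ _ _ _ _ _ _ => rfl⟩

theorem HasCode.nsmul {K N L : ℕ} {G : Type} [AddCommGroup G] {φ : DemandVector N L → G}
    {b c p : ℕ} (h : HasCode K φ b c p) (n : ℕ) : HasCode K φ (n * b) (n * c) (n * p) := by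
  induction n with
  | zero => simpa using HasCode.zero φ
  | succ n ih => simpa only [Nat.succ_mul] using ih.add h

/-- Without caches, all the files are broadcast. -/
theorem HasCode.broadcast {K N L : ℕ} {G : Type} [AddCommGroup G] (φ : DemandVector N L → G) :
    HasCode K φ 1 0 N :=
  ⟨Bool, fun _ _ => Unit, fun _ => Fin N → Bool, inferInstance, fun _ _ => inferInstance,
    fun _ => inferInstance, fun _ _ _ => (), fun _ F => F, by simp, by simp, by simp,
    fun _ _ d _ _ _ h l => congrFun h (d.1 l)⟩

/-- The metadata entropies are bounded by `log |G|` and `log |G ^ K|` in bits, independently of `b`,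
so long files make them negligible. -/
theorem achievable_of_hasCode {K N L : ℕ} {G : Type} [AddCommGroup G] [Fintype G]
    (φ : DemandVector N L → G) {M R : ℝ}
    (h : ∀ b₀ : ℕ, ∃ b c p, b₀ ≤ b ∧ HasCode K φ b c p ∧ (c : ℝ) ≤ M * b ∧ (p : ℝ) ≤ R * b) :
    Achievable K N L M R := by
  intro ε hε B₀
  let _ := Fintype.ofFinite (Fin K → G)
  set a := Real.log (Fintype.card G) / Real.log 2
  set a' := Real.log (Fintype.card (Fin K → G)) / Real.log 2
  obtain ⟨b₁, hb₁⟩ := exists_nat_ge (max a a' / ε)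
  obtain ⟨b, c, p, hb, hcode, hc, hp⟩ := h (max B₀ b₁)
  have hbε : max a a' ≤ ε * b := by
    rw [div_le_iff₀ hε] at hb₁
    have : (b₁ : ℝ) ≤ b := by exact_mod_cast (le_max_right _ _).trans hb
    nlinarith
  obtain ⟨cache, payload, hdec⟩ := hcode.exists_bits
  refine ⟨b, (le_max_left _ _).trans hb, padScheme φ cache payload,
    padScheme_decodable φ cache payload hdec, padScheme_private φ cache payload, ?_, ?_, ?_⟩
  · exact fun D k => (entropy_le_of_card_le _ _ (Fintype.card_fin _).le).trans hc
  · exact fun D => (entropy_le_of_card_le _ _ (Fintype.card_fin _).le).trans hp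
  · exact fun D => ⟨fun k => (lawEntropy_le_log_card _).trans ((le_max_left _ _).trans hbε),
      (lawEntropy_le_log_card _).trans ((le_max_right _ _).trans hbε)⟩

/-! ### The code of the virtual-user scheme -/

theorem card_finset_card_eq_mem {V : Type} [Fintype V] [DecidableEq V] (v : V) {t : ℕ} (ht : 1 ≤ t) :
    Fintype.card {T : Finset V // T.card = t ∧ v ∈ T} = (Fintype.card V - 1).choose (t - 1) := by
  rw [Fintype.card_subtype, ← Finset.card_univ (α := V), ← Finset.card_erase_of_mem (Finset.mem_univ v),
    ← Finset.card_powersetCard]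
  refine Finset.card_bij' (fun T _ => T.erase v) (fun T _ => insert v T) ?_ ?_ ?_ ?_
  · intro T hT
    obtain ⟨h1, h2⟩ := (Finset.mem_filter.mp hT).2
    rw [Finset.mem_powersetCard, Finset.card_erase_of_mem h2, h1]
    exact ⟨Finset.erase_subset_erase v (Finset.subset_univ T), rfl⟩
  · intro T hT
    obtain ⟨h1, h2⟩ := Finset.mem_powersetCard.mp hT
    have hv : v ∉ T := fun h => Finset.notMem_erase v _ (h1 h)
    simp only [Finset.mem_filter, Finset.mem_univ, true_and, Finset.mem_insert_self, and_true]
    rw [Finset.card_insert_of_notMem hv, h2]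
    omega
  · intro T hT
    exact Finset.insert_erase (Finset.mem_filter.mp hT).2.2
  · intro T hT
    obtain ⟨h1, -⟩ := Finset.mem_powersetCard.mp hT
    exact Finset.erase_insert fun h => Finset.notMem_erase v _ (h1 h)

open Classical in
/-- The coded delivery of Maddah-Ali and Niesen to the effective users `(k, g)`, each of which
requests the files with indices `φ⁻¹ (g + w k)`. -/
theorem HasCode.virtualUser {K N L : ℕ} {G : Type} [AddCommGroup G] [Fintype G]
    (φ : DemandVector N L ≃ G) {t : ℕ} (ht : 1 ≤ t) :
    HasCode K φ ((K * Fintype.card G).choose t) (N * (K * Fintype.card G - 1).choose (t - 1))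
      (L * (K * Fintype.card G).choose (t + 1)) := by
  have hV : Fintype.card (Fin K × G) = K * Fintype.card G := by simp
  -- Pieces are extended by zero to all finsets, so that `Q.erase v` can be used as an index without
  -- a proof of its size.
  let ext : ({T : Finset (Fin K × G) // T.card = t} → Bool) → Finset (Fin K × G) → ZMod 2 :=
    fun a T => if h : T.card = t then (if a ⟨T, h⟩ then 1 else 0) else 0
  have hext : ∀ a a' T (h : T.card = t), ext a T = ext a' T ↔ a ⟨T, h⟩ = a' ⟨T, h⟩ := by
    intro a a' T h
    simp only [ext, dif_pos h]
    cases a ⟨T, h⟩ <;> cases a' ⟨T, h⟩ <;> simp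
  refine ⟨{T : Finset (Fin K × G) // T.card = t} → Bool,
    fun k g => Fin N → {T : Finset (Fin K × G) // T.card = t ∧ (k, g) ∈ T} → Bool,
    fun _ => Fin L → {Q : Finset (Fin K × G) // Q.card = t + 1} → ZMod 2,
    inferInstance, fun _ _ => inferInstance, fun _ => inferInstance,
    fun k g F i T => F i ⟨T.1, T.2.1⟩,
    fun w F l Q => ∑ v ∈ Q.1, ext (F ((φ.symm (v.2 + w v.1)).1 l)) (Q.1.erase v), ?_, ?_, ?_, ?_⟩
  · rw [Fintype.card_fun, Fintype.card_finset_len, hV, Fintype.card_bool]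
  · intro k g
    rw [Fintype.card_fun, Fintype.card_fun, card_finset_card_eq_mem _ ht, hV, Fintype.card_bool,
      Fintype.card_fin, ← pow_mul, mul_comm]
  · intro w
    rw [Fintype.card_fun, Fintype.card_fun, Fintype.card_finset_len, hV, ZMod.card,
      Fintype.card_fin, ← pow_mul, mul_comm]
  · intro w k d F F' hC hP l
    have hcached : ∀ i T, T.card = t → (k, φ d - w k) ∈ T → ext (F i) T = ext (F' i) T := by
      intro i T h1 h2
      exact (hext _ _ _ h1).mpr (congrFun (congrFun hC i) ⟨T, h1, h2⟩)
    funext T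
    obtain ⟨T, hT⟩ := T
    rw [← hext]
    by_cases hv : (k, φ d - w k) ∈ T
    · exact hcached _ T hT hv
    -- The missing piece `T` is read off the sum over `Q = T ∪ {(k, key)}`. Every other term is a
    -- piece whose label contains `(k, key)`, hence cached, and this effective user requests `φ⁻¹ (φ
    -- d) = d`.
    · have hQ := congrFun (congrFun hP l)
        ⟨insert (k, φ d - w k) T, by rw [Finset.card_insert_of_notMem hv, hT]⟩
      simp only [Finset.sum_insert hv, Finset.erase_insert hv, sub_add_cancel,
        Equiv.symm_apply_apply] at hQ
      rw [Finset.sum_congr rfl fun v hvT => ?_] at hQ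
      · exact add_right_cancel hQ
      · refine hcached _ _ ?_ ?_
        · rw [Finset.card_erase_of_mem (Finset.mem_insert_of_mem hvT),
            Finset.card_insert_of_notMem hv, hT]
          rfl
        · refine Finset.mem_erase.mpr ⟨fun h => hv (h ▸ hvT), Finset.mem_insert_self _ _⟩

/-! ### Codes with one masking bit for each user and each file -/

open Classical in
/-- The indicator of the set of demanded files. -/
def demandIndicator {N L : ℕ} (d : DemandVector N L) : Fin N → ZMod 2 :=
  fun i => if ∃ l, d.1 l = i then 1 else 0

/-- A placement of one file, whose caches depend on one bit for each user, and symbols of this file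
indexed by `I`. The symbol `s` of user `k` is known to `k` if the bits of the cache and of the
delivery agree; otherwise these symbols and the cache determine the file. Then `L` independent
linear combinations, over the files, of each of the symbols serve all the users. -/
theorem HasCode.masked {K N L : ℕ} {𝔽 : Type} [Field 𝔽] [Fintype 𝔽] {m : ℕ}
    (hm : Fintype.card 𝔽 = 2 ^ m) (hN : N ≤ 2 ^ m) {A I : Type} [Fintype A] [Fintype I]
    {C : Fin K → ZMod 2 → Type} [∀ k v, Fintype (C k v)] (cache : ∀ k v, A → C k v)
    (sym : I → (Fin K → ZMod 2) → A → 𝔽) (useful : I → Fin K → Prop) {b c : ℕ}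
    (hA : Fintype.card A = 2 ^ b) (hC : ∀ k v, Fintype.card (C k v) ≤ 2 ^ c)
    (known : ∀ s k, useful s k → ∀ w a a', cache k (w k) a = cache k (w k) a' →
      sym s w a = sym s w a')
    (decode : ∀ k w a a', cache k (w k + 1) a = cache k (w k + 1) a' →
      (∀ s, useful s k → sym s w a = sym s w a') → a = a') :
    HasCode K (demandIndicator (N := N) (L := L)) b (N * c) (L * (Fintype.card I * m)) := by
  classical
  -- Distinct field elements attached to the files: the coefficients `x i ^ l` with `l < L` form a
  -- Vandermonde matrix on any `L` files.
  obtain ⟨x⟩ : Nonempty (Fin N ↪ 𝔽) :=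
    Function.Embedding.nonempty_of_card_le (by simpa [hm] using hN)
  refine ⟨A, fun k g => ∀ i, C k (g i), fun _ => Fin L → I → 𝔽, inferInstance,
    fun _ _ => inferInstance, fun _ => inferInstance, fun k g F i => cache k (g i) (F i),
    fun w F l s => ∑ i, sym s (fun j => w j i) (F i) * x i ^ (l : ℕ), hA, ?_, ?_, ?_⟩
  · intro k g
    rw [Fintype.card_pi, mul_comm, pow_mul]
    refine (Finset.prod_le_pow_card _ _ _ fun i _ => hC k (g i)).trans_eq ?_
    simp
  · intro w
    rw [Fintype.card_fun, Fintype.card_fun, hm, ← pow_mul, ← pow_mul, Fintype.card_fin]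
    exact le_of_eq (congrArg _ (by ring))
  · intro w k d F F' h1 h2
    -- The key bit is `1_d - w`: modulo 2 it equals `w` on the files that are not demanded and `w +
    -- 1` on the demanded ones. These are the cases of `known` and `decode`.
    have hsame : ∀ i, (¬ ∃ l, d.1 l = i) → cache k (w k i) (F i) = cache k (w k i) (F' i) := by
      intro i hi
      have h := congrFun h1 i
      have e : (demandIndicator d - w k) i = w k i := by
        simp only [Pi.sub_apply, demandIndicator, if_neg hi]
        generalize w k i = z
        revert z
        decide
      dsimp only at h
      rwa [e] at h
    have hdiff : ∀ l, cache k (w k (d.1 l) + 1) (F (d.1 l)) =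
        cache k (w k (d.1 l) + 1) (F' (d.1 l)) := by
      intro l
      have h := congrFun h1 (d.1 l)
      have e : (demandIndicator d - w k) (d.1 l) = w k (d.1 l) + 1 := by
        simp only [Pi.sub_apply, demandIndicator, if_pos (⟨l, rfl⟩ : ∃ l', d.1 l' = d.1 l)]
        generalize w k (d.1 l) = z
        revert z
        decide
      dsimp only at h
      rwa [e] at h
    have hsym : ∀ s, useful s k → ∀ l, sym s (fun j => w j (d.1 l)) (F (d.1 l)) =
        sym s (fun j => w j (d.1 l)) (F' (d.1 l)) := by
      intro s hs
      -- Undemanded symbols cancel in the difference, which leaves `L` Vandermonde equations for the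
      -- `L` demanded symbols.
      let e : Fin N → 𝔽 := fun i => sym s (fun j => w j i) (F i) - sym s (fun j => w j i) (F' i)
      have he : ∀ i, i ∉ Finset.univ.image d.1 → e i = 0 := by
        intro i hi
        rw [sub_eq_zero]
        refine known s k hs _ _ _ (hsame i fun h => hi ?_)
        simpa using h
      have hv : (fun l => e (d.1 l)) = 0 := by
        refine Matrix.eq_zero_of_forall_pow_sum_mul_pow_eq_zero
          (f := fun l => x (d.1 l)) (fun l l' h => d.2.injective (x.injective h)) fun l => ?_
        have h := congrFun (congrFun h2 l) s
        rw [← sub_eq_zero, ← Finset.sum_sub_distrib] at h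
        have h' : ∑ i, e i * x i ^ (l : ℕ) = 0 := by
          rw [← h]
          exact Finset.sum_congr rfl fun i _ => sub_mul _ _ _
        rw [← Finset.sum_subset (Finset.subset_univ (Finset.univ.image d.1))
          (fun i _ hi => by rw [he i hi, zero_mul]),
          Finset.sum_image fun l _ l' _ h => d.2.injective h] at h'
        exact h'
      exact fun l => sub_eq_zero.mp (congrFun hv l)
    exact fun l => decode k (fun j => w j (d.1 l)) _ _ (hdiff l) fun s hs => hsym s hs l

/-- Each file consists of two pieces for each user, one of which is missing in the cache. -/
theorem HasCode.pairs {K N L : ℕ} {𝔽 : Type} [Field 𝔽] [Fintype 𝔽] {m : ℕ}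
    (hm : Fintype.card 𝔽 = 2 ^ m) (hN : N ≤ 2 ^ m) :
    HasCode K (demandIndicator (N := N) (L := L)) (2 * K * m) (N * ((2 * K - 1) * m)) (L * m) := by
  classical
  -- The cache with bit `v` lacks only the piece `(k, v)`, and the single symbol is the sum of the
  -- pieces `(j, w j + 1)`. With bit `w k` all summands are cached; with bit `w k + 1` exactly one
  -- is missing, and it is the missing piece.
  have h := HasCode.masked (L := L) hm hN (A := Fin K × ZMod 2 → 𝔽) (I := Unit)
    (C := fun k v => {u : Fin K × ZMod 2 // u ≠ (k, v)} → 𝔽) (fun k v a u => a u.1)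
    (fun _ w a => ∑ j, a (j, w j + 1)) (fun _ _ => True) (b := 2 * K * m) (c := (2 * K - 1) * m)
    (by
      rw [Fintype.card_fun, hm, Fintype.card_prod, ZMod.card, Fintype.card_fin, ← pow_mul]
      exact congrArg _ (by ring))
    (by
      intro k v
      rw [Fintype.card_fun, hm, ← pow_mul]
      simp [Fintype.card_subtype_compl, mul_comm])
    (by
      intro _ k _ w a a' h
      refine Finset.sum_congr rfl fun j _ => congrFun h ⟨(j, w j + 1), fun hj => ?_⟩
      rw [Prod.mk.injEq] at hj
      obtain ⟨rfl, hj⟩ := hj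
      simp at hj)
    (by
      intro k w a a' h1 h2
      have h2 := h2 () trivial
      rw [← Finset.add_sum_erase _ _ (Finset.mem_univ k),
        ← Finset.add_sum_erase _ _ (Finset.mem_univ k)] at h2
      rw [Finset.sum_congr rfl fun j hj => ?_] at h2
      · funext u
        by_cases hu : u = (k, w k + 1)
        · rw [hu]
          exact add_right_cancel h2
        · exact congrFun h1 ⟨u, hu⟩
      · refine congrFun h1 ⟨(j, w j + 1), fun h => ?_⟩
        exact Finset.ne_of_mem_erase hj (congrArg Prod.fst h))
  simpa using h

theorem card_zmod_two_fun_ne {K : ℕ} (k : Fin K) (v : ZMod 2) :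
    Fintype.card {T : Fin K → ZMod 2 // T k ≠ v} = 2 ^ (K - 1) := by
  have h : (Finset.univ.filter fun T : Fin K → ZMod 2 => T k ≠ v) =
      Fintype.piFinset fun j => if j = k then {v + 1} else Finset.univ := by
    ext T
    simp only [Finset.mem_filter, Finset.mem_univ, true_and, Fintype.mem_piFinset]
    have hz : T k ≠ v ↔ T k = v + 1 := by
      generalize T k = z
      revert z v
      decide
    rw [hz]
    refine ⟨fun hT j => ?_, fun hT => by simpa using hT k⟩
    by_cases hj : j = k
    · simp [hj, hT]
    · simp [hj]
  rw [Fintype.card_subtype, h, Fintype.card_piFinset,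
    ← Finset.mul_prod_erase _ _ (Finset.mem_univ k),
    Finset.prod_congr rfl fun j hj => by rw [if_neg (Finset.ne_of_mem_erase hj)]]
  simp

/-- Counts the delivered symbols that are useful to user `k`, sorted by the size `j` of `S` without
`k`; with the `2 ^ (K - 1)` cached symbols they make up `mdsPieces K t`. -/
theorem card_finset_mem_le_card {K t : ℕ} (k : Fin K) :
    Fintype.card {S : Finset (Fin K) // t + 1 ≤ S.card ∧ k ∈ S} =
      ∑ j ∈ Finset.Icc t (K - 1), (K - 1).choose j := by
  rw [Fintype.card_subtype, Finset.card_eq_sum_card_fiberwise (f := fun S => S.card - 1)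
    (t := Finset.Icc t (K - 1))]
  · refine Finset.sum_congr rfl fun j hj => ?_
    have h := card_finset_card_eq_mem k (Nat.succ_pos j)
    rw [Fintype.card_fin, Nat.succ_sub_one] at h
    rw [← h, Fintype.card_subtype, Finset.filter_filter]
    congr 1
    ext S
    simp only [Finset.mem_filter, Finset.mem_univ, true_and]
    have := (Finset.mem_Icc.mp hj).1
    constructor
    · rintro ⟨⟨h1, h2⟩, h3⟩
      exact ⟨by omega, h2⟩
    · rintro ⟨h1, h2⟩
      exact ⟨⟨by omega, h2⟩, by omega⟩
  · intro S hS
    simp only [Finset.coe_filter, Set.mem_ofPred_eq, Finset.mem_univ, true_and] at hS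
    have := card_finset_fin_le S
    simp only [Finset.coe_Icc, Set.mem_Icc]
    omega

theorem card_finset_le_card {K t : ℕ} :
    Fintype.card {S : Finset (Fin K) // t + 1 ≤ S.card} =
      2 ^ K - ∑ j ∈ Finset.range (t + 1), K.choose j := by
  have h : (Finset.univ.filter fun S : Finset (Fin K) => ¬ t + 1 ≤ S.card).card =
      ∑ j ∈ Finset.range (t + 1), K.choose j := by
    rw [Finset.card_eq_sum_card_fiberwise (f := Finset.card) (t := Finset.range (t + 1))]
    · refine Finset.sum_congr rfl fun j hj => ?_
      have h := Fintype.card_finset_len (α := Fin K) j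
      rw [Fintype.card_fin] at h
      rw [← h, Fintype.card_subtype, Finset.filter_filter]
      congr 1
      ext S
      simp only [Finset.mem_filter, Finset.mem_univ, true_and]
      have := Finset.mem_range.mp hj
      omega
    · intro S hS
      simpa using hS
  have h' := Finset.card_filter_add_card_filter_not (s := Finset.univ)
    fun S : Finset (Fin K) => t + 1 ≤ S.card
  rw [h, Finset.card_univ, Fintype.card_finset, Fintype.card_fin] at h'
  rw [Fintype.card_subtype]
  omega

/-- Each file is encoded by an MDS code into `2 ^ K` symbols, half of which are in each cache. -/
theorem HasCode.mds {K N L : ℕ} {𝔽 : Type} [Field 𝔽] [Fintype 𝔽] {m : ℕ}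
    (hm : Fintype.card 𝔽 = 2 ^ m) (hN : N ≤ 2 ^ m) (hK : K ≤ m) (t : ℕ) :
    HasCode K (demandIndicator (N := N) (L := L)) (mdsPieces K t * m) (N * (2 ^ (K - 1) * m))
      (L * ((2 ^ K - ∑ j ∈ Finset.range (t + 1), K.choose j) * m)) := by
  obtain ⟨x⟩ : Nonempty ((Fin K → ZMod 2) ↪ 𝔽) :=
    Function.Embedding.nonempty_of_card_le (by
      simpa [hm] using Nat.pow_le_pow_right two_pos hK)
  -- Reed–Solomon code: the file is the list of coefficients of a polynomial, evaluated at `2 ^ K`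
  -- distinct points. This is where `K ≤ m` is needed.
  let f : (Fin (mdsPieces K t) → 𝔽) → (Fin K → ZMod 2) → 𝔽 := fun a T =>
    ∑ i, a i * x T ^ (i : ℕ)
  -- The label `w + 1_S` has `k`-th bit `w k + 1` when `k ∈ S`. The cache with bit `w k` contains
  -- this symbol and the one with bit `w k + 1` does not.
  let lbl : Finset (Fin K) → (Fin K → ZMod 2) → (Fin K → ZMod 2) := fun S w j =>
    w j + if j ∈ S then 1 else 0
  rw [← card_finset_le_card]
  refine HasCode.masked hm hN
    (C := fun k v => {T : Fin K → ZMod 2 // T k ≠ v} → 𝔽) (fun k v a T => f a T.1)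
    (fun (S : {S : Finset (Fin K) // t + 1 ≤ S.card}) w a => f a (lbl S.1 w))
    (fun S k => k ∈ S.1) ?_ ?_ ?_ ?_
  · rw [Fintype.card_fun, hm, Fintype.card_fin, ← pow_mul, mul_comm]
  · intro k v
    rw [Fintype.card_fun, hm, card_zmod_two_fun_ne, ← pow_mul, mul_comm]
  · intro S k hk w a a' h
    refine congrFun h ⟨lbl S.1 w, ?_⟩
    simp [lbl, hk]
  · intro k w a a' h1 h2
    -- The cached and the delivered labels are pairwise distinct and number `mdsPieces K t`, enough
    -- to interpolate the polynomial.
    let g : {T : Fin K → ZMod 2 // T k ≠ w k + 1} ⊕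
        {S : Finset (Fin K) // t + 1 ≤ S.card ∧ k ∈ S} → Fin K → ZMod 2 :=
      Sum.elim (fun T => T.1) fun S => lbl S.1 w
    have hlbl : ∀ S : Finset (Fin K), k ∈ S → lbl S w k = w k + 1 := fun S hS => by
      simp [lbl, hS]
    have hg : Function.Injective g := by
      rintro (T | S) (T' | S') h
      · exact congrArg _ (Subtype.ext h)
      · exact absurd ((congrFun h k).trans (hlbl _ S'.2.2)) T.2
      · exact absurd ((congrFun h k).symm.trans (hlbl _ S.2.2)) T'.2
      · refine congrArg _ (Subtype.ext (Finset.ext fun j => ?_))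
        have hj := add_left_cancel (congrFun h j)
        by_cases hjS : j ∈ S.1 <;> by_cases hjS' : j ∈ S'.1 <;> simp [hjS, hjS'] at hj ⊢
    have hf : ∀ u, f a (g u) = f a' (g u) := by
      rintro (T | S)
      · exact congrFun h1 T
      · exact h2 ⟨S.1, S.2.1⟩ S.2.2
    have e : Fin (mdsPieces K t) ≃ {T : Fin K → ZMod 2 // T k ≠ w k + 1} ⊕
        {S : Finset (Fin K) // t + 1 ≤ S.card ∧ k ∈ S} := Fintype.equivOfCardEq (by
      rw [Fintype.card_sum, card_zmod_two_fun_ne, card_finset_mem_le_card, Fintype.card_fin,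
        mdsPieces])
    rw [← sub_eq_zero]
    refine Matrix.eq_zero_of_forall_index_sum_mul_pow_eq_zero (f := fun i => x (g (e i)))
      (x.injective.comp (hg.comp e.injective)) fun i => ?_
    have := sub_eq_zero.mpr (hf (e i))
    rw [← this]
    simp only [f, Pi.sub_apply, sub_mul, Finset.sum_sub_distrib]

/-! ### Memory sharing -/

/-- The memory-load pairs that are approximated by the codes for `φ`. -/
def codeRegion (K : ℕ) {N L : ℕ} {G : Type} [AddCommGroup G] (φ : DemandVector N L → G) :
    Set (ℝ × ℝ) :=
  {v | ∀ δ : ℝ, 0 < δ → ∀ b₀ : ℕ, ∃ b c p, b₀ ≤ b ∧ HasCode K φ b c p ∧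
    (c : ℝ) ≤ (v.1 + δ) * b ∧ (p : ℝ) ≤ (v.2 + δ) * b}

section Sharing

variable {K N L : ℕ} {G : Type} [AddCommGroup G] {φ : DemandVector N L → G}

theorem HasCode.mem_codeRegion {b c p : ℕ} (h : HasCode K φ b c p) (hb : 0 < b) {x y : ℝ}
    (hx : (c : ℝ) ≤ x * b) (hy : (p : ℝ) ≤ y * b) : (x, y) ∈ codeRegion K φ := by
  intro δ hδ b₀
  refine ⟨b₀ * b, b₀ * c, b₀ * p, Nat.le_mul_of_pos_right _ hb, h.nsmul b₀, ?_, ?_⟩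
  · push_cast
    have : (0 : ℝ) ≤ δ * (b₀ * b) := by positivity
    have := mul_le_mul_of_nonneg_left hx (Nat.cast_nonneg (α := ℝ) b₀)
    linarith
  · push_cast
    have : (0 : ℝ) ≤ δ * (b₀ * b) := by positivity
    have := mul_le_mul_of_nonneg_left hy (Nat.cast_nonneg (α := ℝ) b₀)
    linarith

/-- Using about `r * n * b₂` copies of the first code and `s * n * b₁` of the second makes their
shares of the file length proportional to `r` and `s`. Rounding up costs at most `c₁ + c₂`, which
`η` absorbs. It serves for caches and payloads alike. -/
theorem sharing_le {b₁ b₂ c₁ c₂ u₁ u₂ r s n n₁ n₂ η : ℝ} (hb₁ : 1 ≤ b₁) (hb₂ : 1 ≤ b₂)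
    (hc₁ : 0 ≤ c₁) (hc₂ : 0 ≤ c₂) (h₁ : c₁ ≤ u₁ * b₁) (h₂ : c₂ ≤ u₂ * b₂) (hr : 0 ≤ r)
    (hs : 0 ≤ s) (hrs : r + s = 1) (hη : 0 ≤ η) (hn : 0 ≤ n)
    (hn₁ : r * (n * b₂) ≤ n₁) (hn₁' : n₁ ≤ r * (n * b₂) + 1)
    (hn₂ : s * (n * b₁) ≤ n₂) (hn₂' : n₂ ≤ s * (n * b₁) + 1) (hc : c₁ + c₂ ≤ n * η) :
    n₁ * c₁ + n₂ * c₂ ≤ (r * u₁ + s * u₂ + η) * (n₁ * b₁ + n₂ * b₂) := by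
  have hu₁ : 0 ≤ u₁ := nonneg_of_mul_nonneg_left (hc₁.trans h₁) (by linarith)
  have hu₂ : 0 ≤ u₂ := nonneg_of_mul_nonneg_left (hc₂.trans h₂) (by linarith)
  have hb : n * (b₁ * b₂) ≤ n₁ * b₁ + n₂ * b₂ := by
    have e1 := mul_le_mul_of_nonneg_right hn₁ (zero_le_one.trans hb₁)
    have e2 := mul_le_mul_of_nonneg_right hn₂ (zero_le_one.trans hb₂)
    have e3 : n * (b₁ * b₂) = r * (n * b₂) * b₁ + s * (n * b₁) * b₂ := by
      linear_combination (-(n * (b₁ * b₂))) * hrs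
    linarith
  have hbb : 1 ≤ b₁ * b₂ := one_le_mul_of_one_le_of_one_le hb₁ hb₂
  have hcη : c₁ + c₂ ≤ n * (b₁ * b₂) * η := by
    have : n * η * 1 ≤ n * η * (b₁ * b₂) := mul_le_mul_of_nonneg_left hbb (by positivity)
    linarith
  calc n₁ * c₁ + n₂ * c₂ ≤ (r * (n * b₂) + 1) * c₁ + (s * (n * b₁) + 1) * c₂ :=
        add_le_add (mul_le_mul_of_nonneg_right hn₁' hc₁) (mul_le_mul_of_nonneg_right hn₂' hc₂)
    _ = r * n * b₂ * c₁ + s * n * b₁ * c₂ + (c₁ + c₂) := by ring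
    _ ≤ r * n * b₂ * (u₁ * b₁) + s * n * b₁ * (u₂ * b₂) + n * (b₁ * b₂) * η := by
        gcongr
    _ = (r * u₁ + s * u₂ + η) * (n * (b₁ * b₂)) := by ring
    _ ≤ _ := mul_le_mul_of_nonneg_left hb (by positivity)

theorem convex_codeRegion : Convex ℝ (codeRegion K φ) := by
  intro v hv v' hv' r s hr hs hrs δ hδ b₀
  obtain ⟨b₁, c₁, p₁, hb₁, hcode₁, hc₁, hp₁⟩ := hv (δ / 2) (by positivity) 1
  obtain ⟨b₂, c₂, p₂, hb₂, hcode₂, hc₂, hp₂⟩ := hv' (δ / 2) (by positivity) 1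
  obtain ⟨n, hn⟩ := exists_nat_ge (max (b₀ : ℝ) ((c₁ + c₂ + p₁ + p₂) / (δ / 2)))
  have hn₀ : b₀ ≤ n := by exact_mod_cast (le_max_left _ _).trans hn
  have hnδ : (c₁ + c₂ + p₁ + p₂ : ℝ) ≤ n * (δ / 2) :=
    (div_le_iff₀ (by positivity)).mp ((le_max_right _ _).trans hn)
  have hb₁' : (1 : ℝ) ≤ b₁ := by exact_mod_cast hb₁
  have hb₂' : (1 : ℝ) ≤ b₂ := by exact_mod_cast hb₂
  set n₁ := ⌈r * (n * b₂)⌉₊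
  set n₂ := ⌈s * (n * b₁)⌉₊
  have hn₁ : r * (n * b₂) ≤ n₁ := Nat.le_ceil _
  have hn₂ : s * (n * b₁) ≤ n₂ := Nat.le_ceil _
  have hn₁' : (n₁ : ℝ) ≤ r * (n * b₂) + 1 := (Nat.ceil_lt_add_one (by positivity)).le
  have hn₂' : (n₂ : ℝ) ≤ s * (n * b₁) + 1 := (Nat.ceil_lt_add_one (by positivity)).le
  have e : ∀ a a' : ℝ, r * a + s * a' + δ = r * (a + δ / 2) + s * (a' + δ / 2) + δ / 2 := by
    intro a a'
    linear_combination (-(δ / 2)) * hrs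
  have hc₁0 := Nat.cast_nonneg (α := ℝ) c₁
  have hc₂0 := Nat.cast_nonneg (α := ℝ) c₂
  have hp₁0 := Nat.cast_nonneg (α := ℝ) p₁
  have hp₂0 := Nat.cast_nonneg (α := ℝ) p₂
  refine ⟨n₁ * b₁ + n₂ * b₂, n₁ * c₁ + n₂ * c₂, n₁ * p₁ + n₂ * p₂, ?_,
    (hcode₁.nsmul n₁).add (hcode₂.nsmul n₂), ?_, ?_⟩
  · refine hn₀.trans ?_
    have e1 := mul_le_mul_of_nonneg_right hn₁ (zero_le_one.trans hb₁')
    have e2 := mul_le_mul_of_nonneg_right hn₂ (zero_le_one.trans hb₂')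
    have e3 : (n : ℝ) * (b₁ * b₂) = r * (n * b₂) * b₁ + s * (n * b₁) * b₂ := by
      linear_combination (-(n * (b₁ * b₂) : ℝ)) * hrs
    have e4 : (n : ℝ) * 1 ≤ n * (b₁ * b₂) :=
      mul_le_mul_of_nonneg_left (one_le_mul_of_one_le_of_one_le hb₁' hb₂') (Nat.cast_nonneg n)
    have : (n : ℝ) ≤ n₁ * b₁ + n₂ * b₂ := by linarith
    exact_mod_cast this
  · push_cast
    simp only [Prod.fst_add, Prod.smul_fst, smul_eq_mul]
    rw [e]
    exact sharing_le hb₁' hb₂' hc₁0 hc₂0 hc₁ hc₂ hr hs hrs (by positivity) (Nat.cast_nonneg n)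
      hn₁ hn₁' hn₂ hn₂' (by linarith)
  · push_cast
    simp only [Prod.snd_add, Prod.smul_snd, smul_eq_mul]
    rw [e]
    exact sharing_le hb₁' hb₂' hp₁0 hp₂0 hp₁ hp₂ hr hs hrs (by positivity) (Nat.cast_nonneg n)
      hn₁ hn₁' hn₂ hn₂' (by linarith)

/-- The memory constraint must hold exactly, while a code in the region may exceed it by `δ`.
Appending about `δ * b / M` uncached bits to each file, all of them broadcast, restores the ratio
`M`, and the extra load fits into `R - y`. -/
theorem achievable_of_mem_codeRegion [Fintype G] {M y R : ℝ} (hM : 0 < M) (hy : 0 ≤ y)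
    (hR : y < R) (h : (M, y) ∈ codeRegion K φ) : Achievable K N L M R := by
  refine achievable_of_hasCode φ fun b₀ => ?_
  set δ := (R - y) / (2 * (1 + N / M)) with hδ
  have hRy : 0 < R - y := sub_pos.mpr hR
  have hδ0 : 0 < δ := by positivity
  have hδ' : δ * (1 + N / M) = (R - y) / 2 := by
    rw [hδ]
    field_simp
  obtain ⟨b₁, hb₁⟩ := exists_nat_ge ((N : ℝ) / ((R - y) / 2))
  obtain ⟨b, c, p, hb, hcode, hc, hp⟩ := h δ hδ0 (max b₀ b₁)
  have hbN : (N : ℝ) ≤ b * ((R - y) / 2) := by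
    rw [← div_le_iff₀ (by positivity)]
    exact hb₁.trans (by exact_mod_cast (le_max_right _ _).trans hb)
  set r := ⌈δ * b / M⌉₊
  have hr : δ * b / M ≤ r := Nat.le_ceil _
  have hr' : (r : ℝ) ≤ δ * b / M + 1 := (Nat.ceil_lt_add_one (by positivity)).le
  refine ⟨b + r * 1, c + r * 0, p + r * N, ((le_max_left _ _).trans hb).trans (Nat.le_add_right _ _),
    hcode.add ((HasCode.broadcast φ).nsmul r), ?_, ?_⟩
  · push_cast
    rw [div_le_iff₀ hM] at hr
    simp only at hc
    linarith
  · push_cast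
    have h1 : (r : ℝ) * N ≤ (δ * b / M + 1) * N :=
      mul_le_mul_of_nonneg_right hr' (Nat.cast_nonneg N)
    have h2 : (δ * b / M + 1) * N + δ * b = (δ * (1 + N / M)) * b + N := by
      field_simp
      ring
    rw [hδ'] at h2
    have h3 : 0 ≤ R * r := mul_nonneg (hy.trans hR.le) (Nat.cast_nonneg r)
    simp only at hp
    linarith

/-- The lower convex envelope of achievable points is achievable, and it is order optimal as soon as
it contains a point below twice the converse bound. -/
theorem optimalLoad_le_envelope_le [Fintype G] {S : Set (ℝ × ℝ)} {M : ℝ} (hK : 1 ≤ K)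
    (hL : 1 ≤ L) (hLN : L ≤ N) (hM : 0 < M) (hS : S ⊆ codeRegion K φ) (hS' : ∀ v ∈ S, 0 ≤ v.2)
    (hy : ∃ y, (M, y) ∈ convexHull ℝ S ∧ y ≤ 2 * (L * (1 - M / N))) :
    optimalLoad K N L M ≤ lowerConvexEnvelope S M ∧
      lowerConvexEnvelope S M ≤ 2 * optimalLoad K N L M := by
  obtain ⟨y, hyS, hyL⟩ := hy
  -- Nonnegativity also bounds the set of ordinates below, so that the envelope is a genuine
  -- infimum.
  have hnonneg : ∀ v ∈ convexHull ℝ S, (0 : ℝ) ≤ v.2 := by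
    intro v hv
    have hconv : Convex ℝ {v : ℝ × ℝ | 0 ≤ v.2} :=
      convex_halfSpace_ge (IsLinearMap.mk (fun _ _ => rfl) fun _ _ => rfl) 0
    exact convexHull_min hS' hconv hv
  have hconv := convexHull_min hS convex_codeRegion
  have hach : ∀ y', (M, y') ∈ convexHull ℝ S → ∀ R, y' < R → Achievable K N L M R :=
    fun y' hy' R hR => achievable_of_mem_codeRegion hM (hnonneg _ hy') hR (hconv hy')
  have hlow : ∀ R ∈ {R | Achievable K N L M R}, (L : ℝ) * (1 - M / N) ≤ R :=
    fun R hR => Achievable.le_load hR hK hL hLN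
  constructor
  · refine le_csInf ⟨y, hyS⟩ fun y' hy' => le_of_forall_gt_imp_ge_of_dense fun R hR => ?_
    exact csInf_le ⟨_, hlow⟩ (hach y' hy' R hR)
  · have h1 : lowerConvexEnvelope S M ≤ y := csInf_le ⟨0, fun y' hy' => hnonneg _ hy'⟩ hyS
    have h2 : (L : ℝ) * (1 - M / N) ≤ optimalLoad K N L M :=
      le_csInf ⟨y + 1, hach y hyS _ (lt_add_one y)⟩ hlow
    linarith

end Sharing

theorem exists_mem_convexHull_le {S : Set (ℝ × ℝ)} {N L M x y : ℝ} (hN : 0 < N)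
    (h₁ : (x, y) ∈ S) (h₂ : (N, 0) ∈ S) (hx : x < N) (hxM : x ≤ M) (hMN : M ≤ N)
    (hy : y ≤ 2 * (L * (1 - x / N))) :
    ∃ z, (M, z) ∈ convexHull ℝ S ∧ z ≤ 2 * (L * (1 - M / N)) := by
  have hx' : 0 < N - x := sub_pos.mpr hx
  set r := (N - M) / (N - x) with hr
  have hr0 : 0 ≤ r := div_nonneg (sub_nonneg.mpr hMN) hx'.le
  have hr1 : r ≤ 1 := (div_le_one hx').mpr (by linarith)
  have hrx : r * (N - x) = N - M := div_mul_cancel₀ _ hx'.ne'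
  refine ⟨r * y, ?_, ?_⟩
  · have := (convex_convexHull ℝ S) (subset_convexHull ℝ S h₁) (subset_convexHull ℝ S h₂) hr0
      (sub_nonneg.mpr hr1) (add_sub_cancel r 1)
    convert this using 1
    ext
    · simp
      linarith
    · simp
  · have h1 := mul_le_mul_of_nonneg_left hy hr0
    have h2 : r * (1 - x / N) = 1 - M / N := by
      have : r * (1 - x / N) = r * (N - x) / N := by field_simp
      rw [this, hrx]
      field_simp
    calc r * y ≤ r * (2 * (L * (1 - x / N))) := h1
      _ = 2 * (L * (r * (1 - x / N))) := by ring
      _ = _ := by rw [h2]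

/-! ### The virtual-user scheme -/

theorem card_demandVector (N L : ℕ) : Nat.card (DemandVector N L) = N.choose L := by
  have e : DemandVector N L ≃ {S : Finset (Fin N) // S.card = L} :=
    { toFun := fun d => ⟨Finset.univ.image d.1, by
        rw [Finset.card_image_of_injective _ d.2.injective, Finset.card_univ, Fintype.card_fin]⟩
      invFun := fun S => ⟨S.1.orderEmbOfFin S.2, (S.1.orderEmbOfFin S.2).strictMono⟩
      left_inv := fun d => Subtype.ext
        (Finset.orderEmbOfFin_unique _ (fun l => Finset.mem_image_of_mem _ (Finset.mem_univ l))
          d.2).symm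
      right_inv := fun S => Subtype.ext (by
        refine Finset.coe_injective ?_
        rw [Finset.coe_image, Finset.coe_univ, Set.image_univ]
        exact Finset.range_orderEmbOfFin _ _) }
  rw [Nat.card_congr e, Nat.card_eq_fintype_card, Fintype.card_finset_len, Fintype.card_fin]

theorem virtualUserLoad_order_optimal {K N L : ℕ} {M : ℝ} (hK : 1 ≤ K) (hL : 1 ≤ L)
    (hLN : L ≤ N) (hM : (N : ℝ) / 2 ≤ M) (hMN : M ≤ N) :
    optimalLoad K N L M ≤ virtualUserLoad K N L M ∧
      virtualUserLoad K N L M ≤ 2 * optimalLoad K N L M := by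
  have hN : (0 : ℝ) < N := by exact_mod_cast hL.trans hLN
  have hn : 0 < N.choose L := Nat.choose_pos hLN
  have : NeZero (N.choose L) := ⟨hn.ne'⟩
  -- Any bijection with a group will do: only the cardinality enters the number of effective users.
  have φ : DemandVector N L ≃ ZMod (N.choose L) :=
    (Finite.equivFinOfCardEq (card_demandVector N L)).trans
      (Fintype.equivFinOfCardEq (ZMod.card _)).symm
  have hU : 0 < N.choose L * K := Nat.mul_pos hn hK
  refine optimalLoad_le_envelope_le (φ := φ) hK hL hLN (by linarith) ?_ ?_ ?_
  · rintro v (rfl | ⟨t, ht, htU, rfl⟩)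
    · exact (HasCode.broadcast φ).mem_codeRegion one_pos (by simp) (by simp)
    · have h := HasCode.virtualUser (K := K) φ ht
      rw [ZMod.card, mul_comm K] at h
      generalize N.choose L * K = U at *
      have hU' : (U : ℝ) ≠ 0 := by exact_mod_cast hU.ne'
      refine h.mem_codeRegion (Nat.choose_pos htU) (le_of_eq ?_) (le_of_eq ?_)
      · obtain ⟨u, rfl⟩ := Nat.exists_eq_succ_of_ne_zero hU.ne'
        obtain ⟨t, rfl⟩ := Nat.exists_eq_succ_of_ne_zero (Nat.one_le_iff_ne_zero.mp ht)
        have e : ((u + 1 : ℕ) : ℝ) * (u.choose t : ℕ) = (u + 1).choose (t + 1) * (t + 1 : ℕ) := by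
          exact_mod_cast Nat.add_one_mul_choose_eq u t
        simp only [Nat.succ_eq_add_one, Nat.add_sub_cancel, Nat.cast_mul] at *
        rw [div_mul_eq_mul_div, div_mul_eq_mul_div, eq_div_iff hU']
        linear_combination (N : ℝ) * e
      · have e : (U.choose (t + 1) : ℝ) * (t + 1) = U.choose t * (U - t) := by
          rw [← Nat.cast_sub htU]
          exact_mod_cast Nat.choose_succ_right_eq U t
        have ht' : (t : ℝ) + 1 ≠ 0 := by positivity
        rw [Nat.cast_mul]
        field_simp
        linear_combination e
  · rintro v (rfl | ⟨t, ht, htU, rfl⟩)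
    · exact hN.le
    · have : (t : ℝ) ≤ (N.choose L * K : ℕ) := by exact_mod_cast htU
      have := sub_nonneg.mpr this
      dsimp only
      positivity
  · have hlast : ((N : ℝ), (0 : ℝ)) ∈ virtualUserPoints K N L := by
      refine Or.inr ⟨_, hU, le_rfl, ?_⟩
      have hU' : ((N.choose L * K : ℕ) : ℝ) ≠ 0 := by exact_mod_cast hU.ne'
      rw [div_self hU', sub_self, zero_div, mul_zero, one_mul]
    rcases Nat.lt_or_ge 1 (N.choose L * K) with hU1 | hU1
    -- Take `t = ⌊U / 2⌋`: its abscissa is at most `N / 2`, and `U ≤ 2 * (t + 1)` is what puts `(U -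
    -- t) / (t + 1)` below `2 * (U - t) / U`.
    · have hmem : _ ∈ virtualUserPoints K N L := Or.inr ⟨N.choose L * K / 2, by omega, by omega, rfl⟩
      have hU2 : N.choose L * K ≤ 2 * (N.choose L * K / 2 + 1) := by omega
      have hU3 : 2 * (N.choose L * K / 2) ≤ N.choose L * K := by omega
      have hU2' : ((N.choose L * K : ℕ) : ℝ) ≤ 2 * ((N.choose L * K / 2 : ℕ) + 1) := by
        exact_mod_cast hU2
      have hU3' : 2 * ((N.choose L * K / 2 : ℕ) : ℝ) ≤ (N.choose L * K : ℕ) := by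
        exact_mod_cast hU3
      have hU' : (0 : ℝ) < (N.choose L * K : ℕ) := by exact_mod_cast hU
      generalize N.choose L * K / 2 = t at *
      generalize ((N.choose L * K : ℕ) : ℝ) = U at *
      have hx : (t : ℝ) / U ≤ 1 / 2 := by
        rw [div_le_div_iff₀ hU' two_pos]
        linarith
      have hx' : (t : ℝ) / U * N ≤ N / 2 := by nlinarith
      refine exists_mem_convexHull_le hN hmem hlast (by linarith) (hx'.trans hM) hMN ?_
      have e : 2 * ((L : ℝ) * (1 - t / U * N / N)) = L * (2 * (U - t) / U) := by
        field_simp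
      rw [e]
      refine mul_le_mul_of_nonneg_left ?_ (Nat.cast_nonneg L)
      rw [div_le_div_iff₀ (by positivity) hU']
      have : 0 ≤ U - t := by linarith [Nat.cast_nonneg (α := ℝ) t]
      nlinarith
    -- For `U = 1` the half point would be the excluded `t = 0`. Then `L = N`, and `(0, N)` lies
    -- below the line, whose value at `0` is `2 * L`.
    · have hLN' : L = N := by
        by_contra hne
        have h1 : 1 < N.choose L := by
          have := Nat.choose_le_choose L (show L + 1 ≤ N by omega)
          rw [Nat.choose_succ_self_right] at this
          omega
        have := Nat.le_mul_of_pos_right (N.choose L) hK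
        omega
      refine exists_mem_convexHull_le hN (Or.inl rfl) hlast hN (by linarith) hMN ?_
      rw [hLN', zero_div]
      linarith

/-! ### The MDS-based scheme -/

theorem sum_range_choose_le_two_pow {K t : ℕ} (ht : t ≤ K) :
    ∑ j ∈ Finset.range (t + 1), K.choose j ≤ 2 ^ K := by
  rw [← Nat.sum_range_choose]
  exact Finset.sum_le_sum_of_subset (Finset.range_mono (by omega))

theorem mdsPieces_pos (K t : ℕ) : 0 < mdsPieces K t :=
  Nat.add_pos_left (by positivity) _

theorem mdsPieces_zero {K : ℕ} (hK : 1 ≤ K) : mdsPieces K 0 = 2 ^ K := by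
  obtain ⟨k, rfl⟩ := Nat.exists_eq_add_of_le' hK
  rw [mdsPieces, Nat.add_sub_cancel, ← Nat.sum_range_choose k, ← Nat.range_succ_eq_Icc_zero,
    Nat.sum_range_choose, pow_succ]
  ring

theorem mdsPieces_self {K : ℕ} (hK : 1 ≤ K) : mdsPieces K K = 2 ^ (K - 1) := by
  rw [mdsPieces, Finset.Icc_eq_empty (by omega), Finset.sum_empty, add_zero]

theorem mdsLoad_order_optimal {K N L : ℕ} {M : ℝ} (hK : 1 ≤ K) (hL : 1 ≤ L)
    (hLN : L ≤ N) (hM : (N : ℝ) / 2 ≤ M) (hMN : M ≤ N) :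
    optimalLoad K N L M ≤ mdsLoad K N L M ∧ mdsLoad K N L M ≤ 2 * optimalLoad K N L M := by
  have hN : (0 : ℝ) < N := by exact_mod_cast hL.trans hLN
  have hK' : (1 : ℝ) ≤ K := by exact_mod_cast hK
  have hm0 : K + N ≠ 0 := by omega
  -- The exponent `K + N` gives room both for `N` file coefficients and for `2 ^ K` evaluation
  -- points.
  let _ : Fintype (GaloisField 2 (K + N)) := Fintype.ofFinite _
  have hm : Fintype.card (GaloisField 2 (K + N)) = 2 ^ (K + N) := by
    rw [← Nat.card_eq_fintype_card, GaloisField.card 2 _ hm0]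
  have hNm : N ≤ 2 ^ (K + N) := (Nat.le_add_left N K).trans Nat.lt_two_pow_self.le
  refine optimalLoad_le_envelope_le (φ := demandIndicator) hK hL hLN (by linarith) ?_ ?_ ?_
  · rintro v ((rfl | ⟨t, ht, rfl⟩) | rfl)
    · exact (HasCode.broadcast _).mem_codeRegion one_pos (by simp) (by simp)
    · have hp : (mdsPieces K t : ℝ) ≠ 0 := by exact_mod_cast (mdsPieces_pos K t).ne'
      refine (HasCode.mds hm hNm (Nat.le_add_right K N) t).mem_codeRegion
        (Nat.mul_pos (mdsPieces_pos K t) (Nat.pos_of_ne_zero hm0)) (le_of_eq ?_) (le_of_eq ?_)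
      · push_cast
        field_simp
      · push_cast [Nat.cast_sub (sum_range_choose_le_two_pow ht)]
        field_simp
    · refine (HasCode.pairs (K := K) hm hNm).mem_codeRegion (by positivity)
        (le_of_eq ?_) (le_of_eq ?_)
      · push_cast [Nat.cast_sub (show 1 ≤ 2 * K by omega)]
        field_simp
      · push_cast
        field_simp
  · rintro v ((rfl | ⟨t, ht, rfl⟩) | rfl)
    · exact hN.le
    · have : (∑ j ∈ Finset.range (t + 1), (K.choose j : ℝ)) ≤ 2 ^ K := by
        exact_mod_cast sum_range_choose_le_two_pow ht
      have := sub_nonneg.mpr this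
      dsimp only
      positivity
    · dsimp only
      positivity
  · have hlast : ((N : ℝ), (0 : ℝ)) ∈ mdsPoints K N L := by
      refine Or.inl (Or.inr ⟨K, le_rfl, ?_⟩)
      have h1 : (∑ j ∈ Finset.range (K + 1), (K.choose j : ℝ)) = 2 ^ K := by
        exact_mod_cast Nat.sum_range_choose K
      rw [mdsPieces_self hK, h1]
      simp
    -- At `t = 0` the load is `L * (1 - 2⁻ᴷ)`, below `L`, the value of the doubled line at `N / 2`.
    have hfirst : ((N : ℝ) / 2, L * (((2 : ℝ) ^ K - 1) / 2 ^ K)) ∈ mdsPoints K N L := by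
      refine Or.inl (Or.inr ⟨0, Nat.zero_le K, ?_⟩)
      rw [mdsPieces_zero hK]
      obtain ⟨k, rfl⟩ := Nat.exists_eq_add_of_le' hK
      simp [pow_succ]
      field_simp
    refine exists_mem_convexHull_le hN hfirst hlast (by linarith) hM hMN ?_
    have h1 : 2 * ((L : ℝ) * (1 - N / 2 / N)) = L * 1 := by
      field_simp
      norm_num
    rw [h1]
    refine mul_le_mul_of_nonneg_left ?_ (Nat.cast_nonneg L)
    rw [div_le_one (by positivity)]
    linarith

end PrivateCaching

end

theorem theorem5 (K N L : ℕ) (M : ℝ) (hK : 1 ≤ K) (hL : 1 ≤ L) (hLN : L ≤ N)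
    (hM : (N : ℝ) / 2 ≤ M) (hMN : M ≤ (N : ℝ)) :
    (PrivateCaching.optimalLoad K N L M ≤ PrivateCaching.virtualUserLoad K N L M ∧
      PrivateCaching.virtualUserLoad K N L M ≤ 2 * PrivateCaching.optimalLoad K N L M) ∧
    (PrivateCaching.optimalLoad K N L M ≤ PrivateCaching.mdsLoad K N L M ∧
      PrivateCaching.mdsLoad K N L M ≤ 2 * PrivateCaching.optimalLoad K N L M) := by
  exact ⟨PrivateCaching.virtualUserLoad_order_optimal hK hL hLN hM hMN,
    PrivateCaching.mdsLoad_order_optimal hK hL hLN hM hMN⟩
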